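/- Let $n,m\ge 0$ and $k\ge 1$ be integers and let $k\le l\le\infty$. Let $\widehat P^i(\mathbb R^n,\mathbb R^m)$ be the space of homogeneous polynomials of degree $i$ from $\mathbb R^n$ to $\mathbb R^m$ (equivalently, symmetric $i$-linear maps), and let $J^{r}(\mathbb R^n,\mathbb R^m)=\mathbb R^n\times\prod_{i=0}^{r}\widehat P^i(\mathbb R^n,\mathbb R^m)$ be the space of $r$-jets. For an open set $A\subset\mathbb R^n$, let $C^l(A,\mathbb R^m)$ carry the topology of uniform convergence on compact subsets of $A$ of all derivatives of order at most $l$. For $f\in C^l(A,\mathbb R^m)$ and $x\in A$ put $j^{r}f(x)=(x,f(x),Df(x),\dots,D^{r}f(x))$, where $r \le l$ is finite; thus $j^kf(x)=(j^{k-1}f(x),D^kf(x))\in J^k(\mathbb R^n,\mathbb R^m)=J^{k-1}(\mathbb R^n,\mathbb R^m)\times\widehat P^k(\mathbb R^n,\mathbb R^m)$. A Borel measure $\mu\geq 0$ on a topological vector space $V$ is *transverse* to a Borel set $S\subset V$ if $0<\mu(U)<\infty$ for some compact $U\subset V$ and $\mu(S+v)=0$ for every $v\in V$. A property holds for *almost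 every* element of $V$ if the set where it fails is contained in a Borel set to which some Borel measure is transverse. A finite-dimensional subspace $P\subset V$ is a *probe* for a set $T\subset V$ if Lebesgue measure supported on $P$ is transverse to some Borel set containing $V\setminus T$. A *zero set* in a $C^1$ manifold $M$ of dimension $d$ is a subset of $M$ whose image in $\mathbb R^d$ has Lebesgue measure zero in suitable local $C^1$ coordinates of $M$ around each point of $M$. **Theorem (Measure Jet Transversality).** Let $A\subset\mathbb R^n$ be open, and let $M\subset J^{k-1}(\mathbb R^n,\mathbb R^m)$ be an (embedded) $C^1$ manifold of codimension $n$ such that the restriction to $M$ of the projection $\pi:J^{k-1}(\mathbb R^n,\mathbb R^m)\to\mathbb R^n$ onto the first $n$ coordinates is a submersion. Let $Z$ be a zero set in $M\times\widehat P^k(\mathbb R^n,\mathbb R^m)$. Then almost every $f\in C^l(A,\mathbb R^m)$ has the property that $j^kf(x)\notin Z$ for all $x\in A$. Moreover, the space of restrictions to $A$ of the polynomial maps $\mathbb R^n\to\mathbb R^m$ of degree at most $k$ is a probe for the set of $f\in C^l(A,\mathbb R^m)$ with this property. -/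

import Mathlib

open Set Topology MeasureTheory TopologicalSpace
open scoped ContDiff

namespace MeasureJet

/-! ### Prevalence in a real topological vector space with its Borel sets -/

section Prevalence

variable {V : Type*} [AddCommGroup V] [TopologicalSpace V] [MeasurableSpace V]

/-- The measure `μ` is transverse to the (Borel) set `S`: some compact set has positive finite
measure, and every translate of `S` is a null set. -/
def IsTransverse (μ : Measure V) (S : Set V) : Prop :=
  (∃ U : Set V, IsCompact U ∧ 0 < μ U ∧ μ U < ⊤) ∧ ∀ v : V, μ ((fun s => s + v) '' S) = 0

/-- A set is shy if it is contained in a Borel set to which some Borel measure is transverse. -/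
def IsShy (T : Set V) : Prop :=
  ∃ S : Set V, MeasurableSet S ∧ T ⊆ S ∧ ∃ μ : Measure V, IsTransverse μ S

/-- A set is prevalent if its complement is shy; a property holds for almost every element of `V`
if the set where it holds is prevalent. -/
def IsPrevalent (T : Set V) : Prop := IsShy Tᶜ

/-- Lebesgue measure supported on a finite-dimensional subspace `P` of `V`: the image of Lebesgue
measure on `ℝ^d` under a linear isomorphism `ℝ^d ≃ P` followed by the inclusion. Another
isomorphism would only change it by a positive constant factor. -/
noncomputable def lebesgueOn [Module ℝ V] (P : Submodule ℝ V) [FiniteDimensional ℝ P] :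
    Measure V :=
  (volume : Measure (Fin (Module.finrank ℝ P) → ℝ)).map
    fun c => ((Module.finBasis ℝ P).equivFun.symm c : V)

/-- `P` is a probe for `T`: it is finite-dimensional and Lebesgue measure supported on `P` is
transverse to some Borel set that contains the complement of `T`. -/
def IsProbe [Module ℝ V] (P : Submodule ℝ V) (T : Set V) : Prop :=
  ∃ _ : FiniteDimensional ℝ P, ∃ S : Set V, MeasurableSet S ∧ Tᶜ ⊆ S ∧
    IsTransverse (lebesgueOn P) S

end Prevalence

/-! ### Manifolds in a Euclidean space, their tangent spaces and their zero sets -/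

section Manifolds

variable {W : Type*} [NormedAddCommGroup W] [NormedSpace ℝ W]

/-- `φ` is a `C¹` diffeomorphism from an open subset of `W` onto an open subset of `ℝ^d × ℝ^c`
that maps the part of `M` in its domain onto the part of `ℝ^d × {0}` in its range. -/
structure IsFlattening {d c : ℕ}
    (φ : OpenPartialHomeomorph W (EuclideanSpace ℝ (Fin d) × EuclideanSpace ℝ (Fin c)))
    (M : Set W) : Prop where
  contDiffOn : ContDiffOn ℝ 1 φ φ.source
  contDiffOn_symm : ContDiffOn ℝ 1 φ.symm φ.target
  image_eq : φ '' (M ∩ φ.source) = {y | y.2 = 0} ∩ φ.target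

/-- `M` is a (`C¹`, embedded) manifold in `W` of dimension `d` and codimension `c`. -/
def IsManifoldIn (d c : ℕ) (M : Set W) : Prop :=
  ∀ x ∈ M, ∃ φ : OpenPartialHomeomorph W (EuclideanSpace ℝ (Fin d) × EuclideanSpace ℝ (Fin c)),
    IsFlattening φ M ∧ x ∈ φ.source

/-- The tangent space at `x` of a manifold flattened by `φ`: the inverse image of `ℝ^d × {0}` under
the derivative of `φ` at `x`. It does not depend on the choice of `φ`. -/
noncomputable def tangentSpaceAt {d c : ℕ}
    (φ : OpenPartialHomeomorph W (EuclideanSpace ℝ (Fin d) × EuclideanSpace ℝ (Fin c))) (x : W) :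
    Submodule ℝ W :=
  ((⊤ : Submodule ℝ (EuclideanSpace ℝ (Fin d))).prod
    (⊥ : Submodule ℝ (EuclideanSpace ℝ (Fin c)))).comap (fderiv ℝ φ x).toLinearMap

/-- The restriction to the manifold `M` of the differentiable map `g` is a submersion: at each
`x ∈ M` the derivative of `g` maps the tangent space of `M` onto the whole target. -/
def IsSubmersionOn {X : Type*} [NormedAddCommGroup X] [NormedSpace ℝ X]
    (d c : ℕ) (M : Set W) (g : W → X) : Prop :=
  ∀ x ∈ M, ∃ φ : OpenPartialHomeomorph W (EuclideanSpace ℝ (Fin d) × EuclideanSpace ℝ (Fin c)),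
    IsFlattening φ M ∧ x ∈ φ.source ∧
      (tangentSpaceAt φ x).map (fderiv ℝ g x).toLinearMap = ⊤

/-- `S` is a zero set in the manifold `M` of dimension `d` and codimension `c`: it is contained in
`M`, and around each point of `M` there is a flattening of `M` in whose coordinates on `M` (in
`ℝ^d`) the set `S` has Lebesgue measure zero. -/
def IsZeroSetIn (d c : ℕ) (M S : Set W) : Prop :=
  S ⊆ M ∧ ∀ x ∈ M,
    ∃ φ : OpenPartialHomeomorph W (EuclideanSpace ℝ (Fin d) × EuclideanSpace ℝ (Fin c)),
      IsFlattening φ M ∧ x ∈ φ.source ∧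
        volume {a : EuclideanSpace ℝ (Fin d) | (a, 0) ∈ φ '' (S ∩ φ.source)} = 0

end Manifolds

/-! ### Symmetry of higher derivatives of a `C^i` map -/

theorem iteratedFDeriv_comp_perm {E F : Type} [NormedAddCommGroup E] [NormedSpace ℝ E]
    [NormedAddCommGroup F] [NormedSpace ℝ F] {i : ℕ} {f : E → F} {x : E}
    (hf : ContDiffAt ℝ i f x) (σ : Equiv.Perm (Fin i)) (v : Fin i → E) :
    iteratedFDeriv ℝ i f x (v ∘ σ) = iteratedFDeriv ℝ i f x v := by
  have key : ∀ (i : ℕ) {F : Type} [NormedAddCommGroup F] [NormedSpace ℝ F] (f : E → F) (x : E),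
      ContDiffAt ℝ (i + 1 : ℕ) f x → ∀ (j : Fin i) (v : Fin (i + 1) → E),
      iteratedFDeriv ℝ (i + 1) f x (v ∘ Equiv.swap j.castSucc j.succ)
        = iteratedFDeriv ℝ (i + 1) f x v := by
    intro i
    induction i with
    | zero => intro F _ _ f x _ j; exact j.elim0
    | succ i ih =>
      intro F _ _ f x hf j v
      refine Fin.cases ?_ (fun j => ?_) j
      · rcases i with _ | i
        · have hs : IsSymmSndFDerivAt ℝ f x := hf.isSymmSndFDerivAt (by simp)
          have h := hs (v 0) (v 1)
          simp only [iteratedFDeriv_succ_apply_right, iteratedFDeriv_zero_apply]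
          simpa [iteratedFDeriv_succ_apply_right, Fin.init] using h.symm
        · rw [iteratedFDeriv_succ_apply_right (n := i + 2),
            iteratedFDeriv_succ_apply_right (n := i + 2) v]
          have h1 : ContDiffAt ℝ (i + 1 + 1 : ℕ) (fderiv ℝ f) x :=
            hf.fderiv_right (by norm_cast)
          have h2 := ih (fderiv ℝ f) x h1 (0 : Fin (i + 1)) (Fin.init v)
          have ht : Fin.init (v ∘ Equiv.swap (0 : Fin (i + 2)).castSucc (0 : Fin (i + 2)).succ)
              = Fin.init v ∘ Equiv.swap (0 : Fin (i + 1)).castSucc (0 : Fin (i + 1)).succ := by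
            funext a
            simp only [Fin.init, Function.comp_apply]
            congr 1
            have := (Fin.castSucc_injective _).swap_apply (0 : Fin (i + 1)).castSucc
              (0 : Fin (i + 1)).succ a
            rw [← this]
            rfl
          have hl : (v ∘ Equiv.swap (0 : Fin (i + 2)).castSucc (0 : Fin (i + 2)).succ)
              (Fin.last _) = v (Fin.last _) := by
            simp only [Function.comp_apply]
            rw [Equiv.swap_apply_of_ne_of_ne] <;> simp [Fin.ext_iff]
          rw [ht, hl, h2]
      · have hd : DifferentiableAt ℝ (iteratedFDeriv ℝ (i + 1) f) x :=
          hf.differentiableAt_iteratedFDeriv (by norm_cast; omega)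
        rw [hd.iteratedFDeriv_succ_apply_left', hd.iteratedFDeriv_succ_apply_left']
        have ht : Fin.tail (v ∘ Equiv.swap j.succ.castSucc j.succ.succ)
            = Fin.tail v ∘ Equiv.swap j.castSucc j.succ := by
          funext a
          simp only [Fin.tail, Function.comp_apply]
          congr 1
          have := (Fin.succ_injective _).swap_apply j.castSucc j.succ a
          rw [← this]
          rfl
        have h0 : (v ∘ Equiv.swap j.succ.castSucc j.succ.succ) 0 = v 0 := by
          simp only [Function.comp_apply]
          rw [Equiv.swap_apply_of_ne_of_ne] <;> simp [Fin.ext_iff]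
        rw [ht, h0]
        have he : (fun y => iteratedFDeriv ℝ (i + 1) f y
            (Fin.tail v ∘ Equiv.swap j.castSucc j.succ))
            =ᶠ[𝓝 x] fun y => iteratedFDeriv ℝ (i + 1) f y (Fin.tail v) := by
          filter_upwards [hf.eventually (by simp)] with y hy
          exact ih f y (hy.of_le (by norm_cast; omega)) j _
        rw [he.fderiv_eq]
  rcases i with _ | i
  · congr 1; exact Subsingleton.elim _ _
  · have hσ : σ ∈ Submonoid.closure
        (Set.range fun j : Fin i => Equiv.swap j.castSucc j.succ) := by
      rw [Equiv.Perm.mclosure_swap_castSucc_succ]; trivial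
    induction hσ using Submonoid.closure_induction generalizing v with
    | mem τ hτ => obtain ⟨j, rfl⟩ := hτ; exact key i f x hf j v
    | one => rfl
    | mul τ ρ _ _ h1 h2 =>
      rw [Equiv.Perm.coe_mul, ← Function.comp_assoc, h2, h1]

/-! ### Functions of class `C^l` on an open set -/

/-- The vector space of `C^l` functions `A → ℝ^m`, `A ⊆ ℝ^n` open, `l ≤ ∞`; a function on `A` is
extended by zero outside `A`. -/
def cfunSubmodule (n m : ℕ) (l : ℕ∞) (A : Opens (EuclideanSpace ℝ (Fin n))) :
    Submodule ℝ (EuclideanSpace ℝ (Fin n) → EuclideanSpace ℝ (Fin m)) where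
  carrier := {f | ContDiffOn ℝ l f A ∧ ∀ x ∉ A, f x = 0}
  add_mem' := fun hf hg => ⟨hf.1.add hg.1, fun x hx => by simp [hf.2 x hx, hg.2 x hx]⟩
  zero_mem' := ⟨contDiffOn_const, fun _ _ => rfl⟩
  smul_mem' := fun c _ hf => ⟨hf.1.const_smul c, fun x hx => by simp [hf.2 x hx]⟩

/-- The space `C^l(A, ℝ^m)`. (A type of its own, since its topology is not the topology of
pointwise convergence.) -/
def CFun (n m : ℕ) (l : ℕ∞) (A : Opens (EuclideanSpace ℝ (Fin n))) : Type :=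
  cfunSubmodule n m l A

variable {n m : ℕ} {l : ℕ∞} {A : Opens (EuclideanSpace ℝ (Fin n))}

noncomputable instance : AddCommGroup (CFun n m l A) :=
  inferInstanceAs (AddCommGroup (cfunSubmodule n m l A))

noncomputable instance : Module ℝ (CFun n m l A) :=
  inferInstanceAs (Module ℝ (cfunSubmodule n m l A))

instance : CoeFun (CFun n m l A)
    (fun _ => EuclideanSpace ℝ (Fin n) → EuclideanSpace ℝ (Fin m)) := ⟨fun f => f.1⟩

theorem CFun.add_coe (f g : CFun n m l A) : (↑(f + g) : _ → _) = f.1 + g.1 := rfl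

theorem CFun.smul_coe (c : ℝ) (f : CFun n m l A) : (↑(c • f) : _ → _) = c • f.1 := rfl

theorem CFun.contDiffAt (f : CFun n m l A) {i : ℕ} (hi : (i : ℕ∞) ≤ l) (x : A) :
    ContDiffAt ℝ i f x.1 :=
  (f.2.1.contDiffAt (A.isOpen.mem_nhds x.2)).of_le (by exact_mod_cast hi)

/-- The `i`-th derivative, as a linear map from `C^l(A, ℝ^m)` to the continuous functions from `A`
to the `i`-linear maps. -/
noncomputable def derivMap (n m : ℕ) (l : ℕ∞) (A : Opens (EuclideanSpace ℝ (Fin n)))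
    (i : {i : ℕ // (i : ℕ∞) ≤ l}) :
    CFun n m l A →ₗ[ℝ]
      C(A, EuclideanSpace ℝ (Fin n) [×i.1]→L[ℝ] EuclideanSpace ℝ (Fin m)) where
  toFun f := ⟨fun x => iteratedFDeriv ℝ i.1 f x.1, by
    have h := f.2.1.continuousOn_iteratedFDerivWithin (m := i.1) (by exact_mod_cast i.2)
      A.isOpen.uniqueDiffOn
    rw [continuousOn_iff_continuous_domRestrict] at h
    refine h.congr fun x => ?_
    exact iteratedFDerivWithin_of_isOpen i.1 A.isOpen x.2⟩
  map_add' f g := by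
    ext1 x
    exact iteratedFDeriv_add_apply (f.contDiffAt i.2 x) (g.contDiffAt i.2 x)
  map_smul' c f := by
    ext1 x
    exact iteratedFDeriv_const_smul_apply (f.contDiffAt i.2 x)

/-- The usual topology of `C^l(A, ℝ^m)`: uniform convergence on compact subsets of `A` of all
derivatives of order at most `l`. -/
noncomputable instance : TopologicalSpace (CFun n m l A) :=
  ⨅ i : {i : ℕ // (i : ℕ∞) ≤ l}, TopologicalSpace.induced (derivMap n m l A i) inferInstance

instance : IsTopologicalAddGroup (CFun n m l A) :=
  topologicalAddGroup_iInf fun i => topologicalAddGroup_induced (derivMap n m l A i)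

instance : ContinuousSMul ℝ (CFun n m l A) :=
  continuousSMul_iInf fun i => continuousSMul_induced (derivMap n m l A i)

noncomputable instance : MeasurableSpace (CFun n m l A) := borel _

instance : BorelSpace (CFun n m l A) := ⟨rfl⟩

/-- The functions in `C^l(A, ℝ^m)` that are the restriction to `A` of a polynomial map
`ℝ^n → ℝ^m` of degree at most `k`. -/
def polynomials (n m : ℕ) (l : ℕ∞) (A : Opens (EuclideanSpace ℝ (Fin n))) (k : ℕ) :
    Submodule ℝ (CFun n m l A) where
  carrier := {g | ∃ p : Fin m → MvPolynomial (Fin n) ℝ, (∀ j, (p j).totalDegree ≤ k) ∧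
    ∀ x ∈ A, ∀ j, g x j = MvPolynomial.eval (fun i => x i) (p j)}
  add_mem' := by
    rintro f g ⟨p, hp, hf⟩ ⟨q, hq, hg⟩
    refine ⟨fun j => p j + q j, fun j => ?_, fun x hx j => ?_⟩
    · exact (MvPolynomial.totalDegree_add _ _).trans (max_le (hp j) (hq j))
    · rw [CFun.add_coe, Pi.add_apply, PiLp.add_apply, hf x hx j, hg x hx j, map_add]
  zero_mem' := ⟨fun _ => 0, fun _ => by simp, fun x _ j => by rw [map_zero]; rfl⟩
  smul_mem' := by
    rintro c f ⟨p, hp, hf⟩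
    refine ⟨fun j => c • p j, fun j => ?_, fun x hx j => ?_⟩
    · exact (MvPolynomial.totalDegree_smul_le _ _).trans (hp j)
    · rw [CFun.smul_coe, Pi.smul_apply, PiLp.smul_apply, hf x hx j, MvPolynomial.smul_eval,
        smul_eq_mul]

/-! ### Jets -/

/-- The space of homogeneous polynomials of degree `i` from `ℝ^n` to `ℝ^m`, each represented by
the symmetric `i`-linear map that is its `i`-th derivative. -/
def HomPoly (n m i : ℕ) :
    Submodule ℝ (EuclideanSpace ℝ (Fin n) [×i]→L[ℝ] EuclideanSpace ℝ (Fin m)) where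
  carrier := {q | ∀ (σ : Equiv.Perm (Fin i)) (v : Fin i → EuclideanSpace ℝ (Fin n)),
    q (v ∘ σ) = q v}
  add_mem' := fun hp hq σ v => by simp [hp σ v, hq σ v]
  zero_mem' := fun _ _ => rfl
  smul_mem' := fun c q hq σ v => by simp [hq σ v]

/-- The jet space `J^r(ℝ^n, ℝ^m) = ℝ^n × P^r(ℝ^n, ℝ^m)`, where a polynomial of degree at most `r` is
represented by its derivatives of orders `0, …, r` at the base point. -/
abbrev JetSpace (n m r : ℕ) : Type :=
  EuclideanSpace ℝ (Fin n) × ((i : Fin (r + 1)) → HomPoly n m i)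

/-- The `i`-th derivative `D^i f(x)` of a `C^l` function on `A`, where `i ≤ l`. -/
noncomputable def derivAt (i : ℕ) (hi : (i : ℕ∞) ≤ l) (f : CFun n m l A) (x : A) : HomPoly n m i :=
  ⟨iteratedFDeriv ℝ i f x.1, iteratedFDeriv_comp_perm (f.contDiffAt hi x)⟩

/-- The `r`-jet `j^r f(x) = (x, f(x), Df(x), …, D^r f(x))`. -/
noncomputable def jet (r : ℕ) (hr : (r : ℕ∞) ≤ l) (f : CFun n m l A) (x : A) : JetSpace n m r :=
  (x.1, fun i => derivAt (i : ℕ) (le_trans (by exact_mod_cast Nat.lt_succ_iff.mp i.2) hr) f x)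

/-- For `k ≥ 1`, the `k`-jet `j^k f(x)`, decomposed as `(j^{k-1} f(x), D^k f(x))` in
`J^k(ℝ^n, ℝ^m) = J^{k-1}(ℝ^n, ℝ^m) × P̂^k(ℝ^n, ℝ^m)`. -/
noncomputable def splitJet (k : ℕ) (hk : (k : ℕ∞) ≤ l) (f : CFun n m l A) (x : A) :
    JetSpace n m (k - 1) × HomPoly n m k :=
  (jet (k - 1) (le_trans (by exact_mod_cast Nat.sub_le k 1) hk) f x, derivAt k hk f x)

end MeasureJet

open MeasureJet

/-! Codimension `n` in the space of jets of order `k - 1` gives `M` the dimension `d` of the fibre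
over a base point. A polynomial of degree at most `k - 1` is determined by its jet of that order at
any point `x`. Hence, for fixed `f` and a point `(y, t)` of `M × P̂^k` with `y` lying over `x ∈ A`,
exactly one polynomial of degree at most `k`, added to `f`, makes the jet at `x` equal to `(y, t)`:
its part of degree `k` is given by `s = t - D^k f(x)`, and the lower part solves an invertible
linear system (`isInvertible_polyJet_comp_inl`). The bad polynomials are thus the image of `Z` under
a map between spaces of the same dimension, and it must be shown that this image is null.

The map need not be `C¹`, since `D^k f` need only be continuous. But it factors into the shear `(a,
t) ↦ (a, t - D^k f(x(a)))`, which preserves measure by Fubini, followed by a map that involves only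
`j^{k-1} f` and is therefore `C¹`. On compact sets the composition expands measure by a bounded
factor (`exists_measure_image_shear_le`).

Transversality also requires a Borel set. Maps whose jets meet a compact set lying over `A` form a
closed set (`isClosed_jetHits`). A null piece of `Z` lies in `σ`-compact sets of arbitrarily small
measure, and intersecting the corresponding sets of maps gives a Borel set that is null along the
family through every `f` (`isAvoidable_image`). A countable cover handles all of `Z`, and Fubini
passes from the parameters to Lebesgue measure on the polynomials (`lebesgueOn_image_add_eq_zero`).
-/

namespace MeasureJet

/-! ### Images of small sets under a sheared `C¹` map -/

section Shear

variable {E H : Type*} [NormedAddCommGroup E] [NormedSpace ℝ E] [FiniteDimensional ℝ E]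
  [MeasurableSpace E] [BorelSpace E] [NormedAddCommGroup H] [NormedSpace ℝ H]
  [FiniteDimensional ℝ H] [MeasurableSpace H] [BorelSpace H]

/-- The composition of a continuous shear and a `C¹` map expands the measure of subsets of a compact
set by a bounded factor only. -/
theorem exists_measure_image_shear_le (μ : Measure E) (ν : Measure H) [μ.IsAddHaarMeasure]
    [ν.IsAddHaarMeasure] {U : Set E} (hU : IsOpen U) {D : E → H} (hD : ContinuousOn D U)
    {R : E × H → E × H} (hR : ContDiffOn ℝ 1 R (U ×ˢ univ)) {K : Set (E × H)} (hK : IsCompact K)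
    (hKU : K ⊆ U ×ˢ univ) :
    ∃ C : NNReal, ∀ B ⊆ K, MeasurableSet B →
      μ.prod ν ((fun p => R (p.1, p.2 - D p.1)) '' B) ≤ C * μ.prod ν B := by
  have : ProperSpace E := FiniteDimensional.proper ℝ E
  have : ProperSpace H := FiniteDimensional.proper ℝ H
  have hUo : IsOpen (U ×ˢ (univ : Set H)) := hU.prod isOpen_univ
  set sh : E × H → E × H := fun p => (p.1, p.2 - D p.1) with hsh
  have hshc : ContinuousOn sh K := by
    refine continuousOn_fst.prodMk (continuousOn_snd.sub ?_)
    exact hD.comp continuousOn_fst fun p hp => (hKU hp).1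
  have hshK : IsCompact (sh '' K) := hK.image_of_continuousOn hshc
  have hshU : sh '' K ⊆ U ×ˢ univ := by
    rintro _ ⟨p, hp, rfl⟩
    exact ⟨(hKU hp).1, trivial⟩
  have hdet : ContinuousOn (fun p => |(fderiv ℝ R p).det|) (sh '' K) :=
    (ContinuousLinearMap.continuous_det.comp_continuousOn
      ((hR.continuousOn_fderiv_of_isOpen hUo le_rfl).mono hshU)).abs
  obtain ⟨C, hC⟩ := hshK.bddAbove_image hdet
  refine ⟨C.toNNReal, fun B hBK hB => ?_⟩
  -- Extension by zero outside `U` makes the shear globally defined and measurable.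
  have hD' : Measurable (U.indicator D) := by
    classical
    rw [← Set.piecewise_eq_indicator]
    exact hD.measurable_piecewise continuousOn_const hU.measurableSet
  -- The inverse shear translates each fibre, so Fubini gives invariance without any
  -- differentiability of `D`.
  have hmp : MeasurePreserving (fun p : E × H => (p.1, p.2 + U.indicator D p.1))
      (μ.prod ν) (μ.prod ν) := by
    refine (MeasurePreserving.id μ).skew_product (g := fun a t => t + U.indicator D a) ?_ ?_
    · exact measurable_snd.add (hD'.comp measurable_fst)
    · exact Filter.Eventually.of_forall fun a => map_add_right_eq_self ν _
  have hpre : sh '' B = (fun p : E × H => (p.1, p.2 + U.indicator D p.1)) ⁻¹' B := by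
    ext ⟨a, s⟩
    constructor
    · rintro ⟨p, hp, h⟩
      have h1 : p.1 ∈ U := (hKU (hBK hp)).1
      simp only [hsh, Prod.mk.injEq] at h
      obtain ⟨rfl, rfl⟩ := h
      simpa [h1] using hp
    · intro h
      have h1 : a ∈ U := (hKU (hBK h)).1
      refine ⟨_, h, ?_⟩
      simp [hsh, h1]
  have hshB : MeasurableSet (sh '' B) := by rw [hpre]; exact hmp.measurable hB
  have hvol : μ.prod ν (sh '' B) = μ.prod ν B := by
    rw [hpre]; exact hmp.measure_preimage hB.nullMeasurableSet
  have himg : (fun p => R (p.1, p.2 - D p.1)) '' B = R '' (sh '' B) := by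
    rw [image_image]
  rw [himg, ← hvol]
  refine (addHaar_image_le_lintegral_abs_det_fderiv (μ.prod ν) (f' := fderiv ℝ R) hshB
    fun p hp => ?_).trans ?_
  · have hp' : p ∈ U ×ˢ univ := hshU (image_mono hBK hp)
    exact ((hR.differentiableOn one_ne_zero).differentiableAt
      (hUo.mem_nhds hp')).hasFDerivAt.hasFDerivWithinAt
  · rw [← setLIntegral_const]
    refine setLIntegral_mono' hshB fun p hp => ?_
    exact ENNReal.ofReal_le_ofReal (hC (mem_image_of_mem _ (image_mono hBK hp)))


end Shear

/-- A `C¹` map between real vector spaces of the same dimension maps null sets to null sets. -/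
theorem addHaar_image_eq_zero_of_finrank_eq {E F : Type*} [NormedAddCommGroup E] [NormedSpace ℝ E]
    [FiniteDimensional ℝ E] [MeasurableSpace E] [BorelSpace E] [NormedAddCommGroup F]
    [NormedSpace ℝ F] [FiniteDimensional ℝ F] [MeasurableSpace F] [BorelSpace F]
    (h : Module.finrank ℝ E = Module.finrank ℝ F) (μ : Measure E) (ν : Measure F)
    [μ.IsAddHaarMeasure] [ν.IsAddHaarMeasure] {f : E → F} {s : Set E}
    (hf : DifferentiableOn ℝ f s) (hs : μ s = 0) : ν (f '' s) = 0 := by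
  let e : E ≃L[ℝ] F := ContinuousLinearEquiv.ofFinrankEq h
  have : ProperSpace E := FiniteDimensional.proper ℝ E
  obtain ⟨c', hc'0, hc'⟩ := (e : E →ₗ[ℝ] F).exists_map_addHaar_eq_smul_addHaar μ ν e.surjective
  have h0 : μ ((e.symm ∘ f) '' s) = 0 :=
    addHaar_image_eq_zero_of_differentiableOn_of_addHaar_eq_zero μ
      (e.symm.differentiable.comp_differentiableOn hf) hs
  have h1 : Measure.map e μ (f '' s) = 0 := by
    refine (e.toHomeomorph.toMeasurableEquiv.map_apply _).trans ?_
    convert h0 using 2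
    rw [image_comp]
    exact (e.toLinearEquiv.toEquiv.image_symm_eq_preimage _).symm
  have h2 : (c' • ν) (f '' s) = 0 := by rw [← hc']; exact h1
  simpa [hc'0.ne'] using h2

/-! ### Probes -/

section Probes

theorem continuous_finBasis_symm {V : Type*} [AddCommGroup V] [Module ℝ V] [TopologicalSpace V]
    [IsTopologicalAddGroup V] [ContinuousSMul ℝ V] (P : Submodule ℝ V) [FiniteDimensional ℝ P] :
    Continuous fun c : Fin (Module.finrank ℝ P) → ℝ =>
      ((Module.finBasis ℝ P).equivFun.symm c : V) :=
  (P.subtype ∘ₗ (Module.finBasis ℝ P).equivFun.symm.toLinearMap).continuous_of_finiteDimensional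

variable {V : Type*} [AddCommGroup V] [Module ℝ V] [TopologicalSpace V] [IsTopologicalAddGroup V]
  [ContinuousSMul ℝ V] [MeasurableSpace V] [BorelSpace V]

theorem exists_isCompact_lebesgueOn [T2Space V] (P : Submodule ℝ V) [FiniteDimensional ℝ P] :
    ∃ U : Set V, IsCompact U ∧ 0 < lebesgueOn P U ∧ lebesgueOn P U < ⊤ := by
  set ι := fun c : Fin (Module.finrank ℝ P) → ℝ => ((Module.finBasis ℝ P).equivFun.symm c : V)
    with hι
  have hc : Continuous ι := continuous_finBasis_symm P
  have hinj : Function.Injective ι := fun a b h =>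
    (Module.finBasis ℝ P).equivFun.symm.injective (Subtype.ext h)
  have hK : IsCompact (ι '' Metric.closedBall 0 1) := (isCompact_closedBall _ _).image hc
  refine ⟨_, hK, ?_⟩
  have : lebesgueOn P (ι '' Metric.closedBall 0 1) =
      volume (Metric.closedBall (0 : Fin (Module.finrank ℝ P) → ℝ) 1) := by
    rw [lebesgueOn, Measure.map_apply hc.measurable hK.isClosed.measurableSet,
      hinj.preimage_image]
  rw [this]
  exact ⟨Metric.measure_closedBall_pos _ _ one_pos, measure_closedBall_lt_top⟩

/-- If every translate of `S` is null along a finite-dimensional family with values in `P`, then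
every translate of `S` is null for Lebesgue measure on `P`. -/
theorem lebesgueOn_image_add_eq_zero [T2Space V] {X : Type*} [NormedAddCommGroup X] [NormedSpace ℝ X]
    [FiniteDimensional ℝ X] [MeasurableSpace X] [BorelSpace X] (μ : Measure X)
    [μ.IsAddHaarMeasure] (P : Submodule ℝ V) [FiniteDimensional ℝ P] (T : X →ₗ[ℝ] V)
    (hT : ∀ x, T x ∈ P) {S : Set V} (hS : MeasurableSet S)
    (h : ∀ f : V, μ {x | f + T x ∈ S} = 0) (v : V) :
    lebesgueOn P ((fun s => s + v) '' S) = 0 := by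
  set ι := fun c : Fin (Module.finrank ℝ P) → ℝ => ((Module.finBasis ℝ P).equivFun.symm c : V)
    with hι
  have : ProperSpace X := FiniteDimensional.proper ℝ X
  have hc : Continuous ι := continuous_finBasis_symm P
  have hTc : Continuous T := T.continuous_of_finiteDimensional
  have hpre : (fun s => s + v) '' S = (fun s => s - v) ⁻¹' S := by
    ext x; simp [sub_eq_add_neg]
  have hsub : Continuous fun s : V => s - v := continuous_id.sub continuous_const
  rw [hpre, lebesgueOn, Measure.map_apply hc.measurable (hsub.measurable hS)]
  have hW : MeasurableSet {q : X × (Fin (Module.finrank ℝ P) → ℝ) | ι q.2 - v + T q.1 ∈ S} := by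
    have : Continuous fun q : X × (Fin (Module.finrank ℝ P) → ℝ) => ι q.2 - v + T q.1 :=
      ((hc.comp continuous_snd).sub continuous_const).add (hTc.comp continuous_fst)
    exact this.measurable hS
  -- Fubini in both orders: the slices at fixed `c` are null by hypothesis, so almost every slice at
  -- fixed `x` is null.
  have h0 : (volume.prod μ) (Prod.swap ⁻¹'
      {q : X × (Fin (Module.finrank ℝ P) → ℝ) | ι q.2 - v + T q.1 ∈ S}) = 0 := by
    rw [Measure.measure_prod_null (measurable_swap hW)]
    exact Filter.Eventually.of_forall fun c => h (ι c - v)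
  have h1 : (μ.prod volume)
      {q : X × (Fin (Module.finrank ℝ P) → ℝ) | ι q.2 - v + T q.1 ∈ S} = 0 := by
    rw [← Measure.prod_swap, Measure.map_apply measurable_swap hW]
    exact h0
  rw [Measure.measure_prod_null hW] at h1
  -- A single good `x` suffices: since `T x` lies in `P`, the slice is a translate, within the
  -- coordinates on `P`, of the set in question.
  obtain ⟨x, hx⟩ := h1.exists
  set b : Fin (Module.finrank ℝ P) → ℝ := (Module.finBasis ℝ P).equivFun ⟨T x, hT x⟩ with hb
  have hιb : ι b = T x := by
    simp only [hι, hb, LinearEquiv.symm_apply_apply]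
  have hadd : ∀ c, ι (c + b) = ι c + T x := fun c => by
    rw [← hιb]; simp only [hι, map_add, Submodule.coe_add]
  have hset : Prod.mk x ⁻¹' {q : X × (Fin (Module.finrank ℝ P) → ℝ) | ι q.2 - v + T q.1 ∈ S}
      = (fun c => c + b) ⁻¹' (ι ⁻¹' ((fun s => s - v) ⁻¹' S)) := by
    ext c
    simp only [mem_preimage, mem_ofPred_eq, hadd]
    rw [sub_add_eq_add_sub]
  have hx' : volume _ = 0 := hx
  rw [hset, measure_preimage_add_right] at hx'
  exact hx'

end Probes

/-! ### Derivatives of homogeneous polynomials -/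

instance finiteDimensional_continuousMultilinearMap {ι E F : Type*} [Finite ι]
    [NormedAddCommGroup E] [NormedSpace ℝ E] [FiniteDimensional ℝ E] [NormedAddCommGroup F]
    [NormedSpace ℝ F] [FiniteDimensional ℝ F] :
    FiniteDimensional ℝ (ContinuousMultilinearMap ℝ (fun _ : ι => E) F) :=
  FiniteDimensional.of_injective
    (ContinuousMultilinearMap.toMultilinearMapLinear :
      ContinuousMultilinearMap ℝ (fun _ : ι => E) F →ₗ[ℝ] _)
    ContinuousMultilinearMap.toMultilinearMap_injective

section Diagonal

variable {E F : Type} [NormedAddCommGroup E] [NormedSpace ℝ E] [NormedAddCommGroup F]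
  [NormedSpace ℝ F]

/-- The homogeneous polynomial `y ↦ s (y, …, y)`. -/
def diagonal {i : ℕ} (s : E [×i]→L[ℝ] F) (y : E) : F := s fun _ => y

theorem contDiff_diagonal {i : ℕ} (s : E [×i]→L[ℝ] F) {N : WithTop ℕ∞} :
    ContDiff ℝ N (diagonal s) :=
  s.contDiff.comp (contDiff_pi.2 fun _ => contDiff_id)

theorem contDiff_smul_diagonal {i : ℕ} (a : ℝ) (s : E [×i]→L[ℝ] F) {N : WithTop ℕ∞} :
    ContDiff ℝ N (a • diagonal s) :=
  ContDiff.const_smul (f := diagonal s) a (contDiff_diagonal s)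

/-- By the product rule the derivative is a sum of `i + 1` terms, one for each slot that receives
`v`; symmetry makes them all equal to the term for the last slot. -/
theorem fderiv_diagonal {i : ℕ} (s : E [×(i + 1)]→L[ℝ] F)
    (hs : ∀ (σ : Equiv.Perm (Fin (i + 1))) (v : Fin (i + 1) → E), s (v ∘ σ) = s v) :
    fderiv ℝ (diagonal s) = ((i + 1 : ℕ) : ℝ) • diagonal s.curryRight := by
  ext y v
  have h1 : HasFDerivAt (diagonal s) ((s.linearDeriv fun _ => y).comp
      (ContinuousLinearMap.pi fun _ => ContinuousLinearMap.id ℝ E)) y :=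
    (s.hasFDerivAt fun _ => y).comp y (hasFDerivAt_pi.2 fun _ => hasFDerivAt_id y)
  rw [h1.fderiv]
  have h2 : ∀ j : Fin (i + 1), s (Function.update (fun _ => y) j v) =
      s (Fin.snoc (fun _ => y) v) := fun j => by
    rw [← hs (Equiv.swap j (Fin.last i))]
    congr 1
    funext a
    refine Fin.lastCases ?_ (fun a => ?_) a
    · simp
    · rw [Fin.snoc_castSucc, Function.comp_apply, Function.update_apply, if_neg]
      intro h
      rw [Equiv.swap_apply_eq_iff, Equiv.swap_apply_left] at h
      exact (Fin.castSucc_lt_last a).ne h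
  simp [ContinuousMultilinearMap.linearDeriv_apply, h2, diagonal,
    ContinuousMultilinearMap.curryRight_apply, ← Nat.cast_smul_eq_nsmul ℝ]

/-- A permutation of the first `i` slots extends to one of all `i + 1` slots that fixes the last. -/
theorem curryRight_comp_perm {i : ℕ} (s : E [×(i + 1)]→L[ℝ] F)
    (hs : ∀ (σ : Equiv.Perm (Fin (i + 1))) (v : Fin (i + 1) → E), s (v ∘ σ) = s v)
    (σ : Equiv.Perm (Fin i)) (v : Fin i → E) : s.curryRight (v ∘ σ) = s.curryRight v := by
  ext w
  rw [ContinuousMultilinearMap.curryRight_apply, ContinuousMultilinearMap.curryRight_apply,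
    ← hs ((finSuccEquivLast.trans (Equiv.optionCongr σ)).trans finSuccEquivLast.symm)
      (Fin.snoc v w)]
  congr 1
  funext a
  refine Fin.lastCases ?_ (fun a => ?_) a <;> simp

/-- Each differentiation lowers the degree by one and contributes the old degree as a factor. The
target varies in the induction because the derivative takes values in `E →L[ℝ] F`. -/
theorem iteratedFDeriv_diagonal_self : ∀ (i : ℕ) {F : Type} [NormedAddCommGroup F]
    [NormedSpace ℝ F] (s : E [×i]→L[ℝ] F)
    (_ : ∀ (σ : Equiv.Perm (Fin i)) (v : Fin i → E), s (v ∘ σ) = s v) (x : E),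
    iteratedFDeriv ℝ i (diagonal s) x = (i.factorial : ℝ) • s := by
  intro i
  induction i with
  | zero =>
    intro F _ _ s _ x
    ext v
    simp only [iteratedFDeriv_zero_apply, diagonal, Nat.factorial_zero, Nat.cast_one, one_smul]
    congr 1
    exact Subsingleton.elim _ _
  | succ i ih =>
    intro F _ _ s hs x
    rw [iteratedFDeriv_succ_eq_comp_right, Function.comp_apply]
    change (continuousMultilinearCurryRightEquiv' ℝ i E F).symm
      (iteratedFDeriv ℝ i (fderiv ℝ (diagonal s)) x) = _
    rw [fderiv_diagonal s hs, iteratedFDeriv_const_smul_apply (contDiff_diagonal _).contDiffAt,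
      ih _ (curryRight_comp_perm s hs), smul_smul, map_smul, Nat.factorial_succ, Nat.cast_mul]
    congr 1
    exact s.uncurry_curryRight

theorem iteratedFDeriv_diagonal_zero : ∀ (i j : ℕ) {F : Type} [NormedAddCommGroup F]
    [NormedSpace ℝ F] (s : E [×i]→L[ℝ] F)
    (_ : ∀ (σ : Equiv.Perm (Fin i)) (v : Fin i → E), s (v ∘ σ) = s v), j < i →
    iteratedFDeriv ℝ j (diagonal s) 0 = 0 := by
  intro i
  induction i with
  | zero => intro j F _ _ s _ h; omega
  | succ i ih =>
    intro j F _ _ s hs h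
    rcases j with _ | j
    · ext v
      simp only [iteratedFDeriv_zero_apply, diagonal]
      exact s.map_coord_zero 0 rfl
    · rw [iteratedFDeriv_succ_eq_comp_right, Function.comp_apply]
      change (continuousMultilinearCurryRightEquiv' ℝ j E F).symm
        (iteratedFDeriv ℝ j (fderiv ℝ (diagonal s)) 0) = _
      rw [fderiv_diagonal s hs, iteratedFDeriv_const_smul_apply (contDiff_diagonal _).contDiffAt,
        ih j _ (curryRight_comp_perm s hs) (by omega), smul_zero]
      exact LinearIsometryEquiv.map_zero _

theorem iteratedFDeriv_succ_eq_zero_of_forall_eq {G : E → F} {a : ℕ} {c : E [×a]→L[ℝ] F}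
    (h : ∀ x, iteratedFDeriv ℝ a G x = c) (x : E) : iteratedFDeriv ℝ (a + 1) G x = 0 := by
  have h' : iteratedFDeriv ℝ a G = fun _ => c := funext h
  rw [← norm_eq_zero, ← norm_fderiv_iteratedFDeriv, h', fderiv_fun_const]
  exact norm_zero (E := E →L[ℝ] E [×a]→L[ℝ] F)

theorem iteratedFDeriv_diagonal_of_lt {i j : ℕ} (s : E [×i]→L[ℝ] F)
    (hs : ∀ (σ : Equiv.Perm (Fin i)) (v : Fin i → E), s (v ∘ σ) = s v) (h : i < j) (x : E) :
    iteratedFDeriv ℝ j (diagonal s) x = 0 := by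
  induction j, h using Nat.le_induction generalizing x with
  | base => exact iteratedFDeriv_succ_eq_zero_of_forall_eq (iteratedFDeriv_diagonal_self i s hs) x
  | succ j _ ih => exact iteratedFDeriv_succ_eq_zero_of_forall_eq ih x

/-- A polynomial of degree at most `r` whose derivatives of order at most `r` vanish at a point
vanishes together with its derivatives. -/
theorem iteratedFDeriv_eq_zero_of_jet_eq_zero {G : E → F} (hG : ContDiff ℝ ∞ G) {r : ℕ}
    (hr : ∀ x, iteratedFDeriv ℝ (r + 1) G x = 0) {x : E}
    (hx : ∀ i ≤ r, iteratedFDeriv ℝ i G x = 0) {i : ℕ} (hi : i ≤ r + 1) (y : E) :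
    iteratedFDeriv ℝ i G y = 0 := by
  induction hi using Nat.decreasingInduction generalizing y with
  | self => exact hr y
  | of_succ i hi ih =>
    have hd : Differentiable ℝ (iteratedFDeriv ℝ i G) :=
      hG.differentiable_iteratedFDeriv (by exact_mod_cast ENat.natCast_lt_top i)
    rw [is_const_of_fderiv_eq_zero hd (fun z => ?_) y x, hx i (by omega)]
    rw [← norm_eq_zero, norm_fderiv_iteratedFDeriv, ih z, norm_zero]

end Diagonal

/-! ### Jets of smooth maps and the polynomial family -/

/-- The norm of the homogeneous polynomials, as a shortcut instance. -/
noncomputable abbrev normedAddCommGroupHomPoly (n m i : ℕ) : NormedAddCommGroup (HomPoly n m i) :=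
  Submodule.normedAddCommGroup _

attribute [local instance] normedAddCommGroupHomPoly

/-- The normed space of the homogeneous polynomials, as a shortcut instance. -/
noncomputable abbrev normedSpaceHomPoly (n m i : ℕ) : NormedSpace ℝ (HomPoly n m i) :=
  Submodule.normedSpace _

attribute [local instance] normedSpaceHomPoly

section Jets

variable {n m : ℕ} {l : ℕ∞} {A : Opens (EuclideanSpace ℝ (Fin n))}

instance finiteDimensional_homPoly (n m i : ℕ) : FiniteDimensional ℝ (HomPoly n m i) :=
  inferInstance

/-- The jets of order `r` at a given point. -/
abbrev JetFiber (n m r : ℕ) : Type := (i : Fin (r + 1)) → HomPoly n m i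

/-- A linear projection onto the symmetric multilinear maps. -/
noncomputable def symProj (n m i : ℕ) :
    (EuclideanSpace ℝ (Fin n) [×i]→L[ℝ] EuclideanSpace ℝ (Fin m)) →L[ℝ] HomPoly n m i :=
  ((HomPoly n m i).subtype.exists_leftInverse_of_injective
    (HomPoly n m i).ker_subtype).choose.toContinuousLinearMap

theorem symProj_coe {i : ℕ} (q : HomPoly n m i) : symProj n m i q = q :=
  LinearMap.congr_fun ((HomPoly n m i).subtype.exists_leftInverse_of_injective
    (HomPoly n m i).ker_subtype).choose_spec q

/-- The tuple of derivatives of order at most `r`. -/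
noncomputable def jetOf (r : ℕ) (G : EuclideanSpace ℝ (Fin n) → EuclideanSpace ℝ (Fin m))
    (x : EuclideanSpace ℝ (Fin n)) : JetFiber n m r :=
  fun i => symProj n m i (iteratedFDeriv ℝ i G x)

/-- With `r = k - 1`, this supplies the `C¹` dependence of the lower jet on the point; the
derivative of order `k` itself need only be continuous. -/
theorem contDiffAt_jetOf {r : ℕ} {G : EuclideanSpace ℝ (Fin n) → EuclideanSpace ℝ (Fin m)}
    {x : EuclideanSpace ℝ (Fin n)} (hG : ContDiffAt ℝ (r + 1 : ℕ) G x) :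
    ContDiffAt ℝ 1 (jetOf r G) x := by
  refine contDiffAt_pi.2 fun i => (symProj n m i).contDiff.contDiffAt.comp x ?_
  refine hG.iteratedFDeriv_right ?_
  have := i.2
  exact_mod_cast (by omega : 1 + (i : ℕ) ≤ r + 1)

theorem jetOf_add {r : ℕ} {G G' : EuclideanSpace ℝ (Fin n) → EuclideanSpace ℝ (Fin m)}
    {x : EuclideanSpace ℝ (Fin n)} (hG : ContDiffAt ℝ r G x) (hG' : ContDiffAt ℝ r G' x) :
    jetOf r (G + G') x = jetOf r G x + jetOf r G' x := by
  funext i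
  have hi : ((i : ℕ) : WithTop ℕ∞) ≤ (r : ℕ) := by exact_mod_cast Nat.lt_succ_iff.1 i.2
  simp only [jetOf, Pi.add_apply]
  rw [iteratedFDeriv_add_apply (hG.of_le hi) (hG'.of_le hi), map_add]

theorem jetOf_smul {r : ℕ} {G : EuclideanSpace ℝ (Fin n) → EuclideanSpace ℝ (Fin m)}
    {x : EuclideanSpace ℝ (Fin n)} (hG : ContDiffAt ℝ r G x) (c : ℝ) :
    jetOf r (c • G) x = c • jetOf r G x := by
  funext i
  have hi : ((i : ℕ) : WithTop ℕ∞) ≤ (r : ℕ) := by exact_mod_cast Nat.lt_succ_iff.1 i.2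
  simp only [jetOf, Pi.smul_apply]
  rw [iteratedFDeriv_const_smul_apply (hG.of_le hi), map_smul]

theorem jet_eq_jetOf {r : ℕ} (hr : (r : ℕ∞) ≤ l) (f : CFun n m l A) (x : A) :
    jet r hr f x = (x.1, jetOf r f.1 x.1) := by
  refine Prod.ext rfl (funext fun i => ?_)
  exact (symProj_coe _).symm

/-- The polynomial map with prescribed derivatives at the origin. -/
noncomputable def taylorPoly (n m r : ℕ) : JetFiber n m r →ₗ[ℝ]
    (EuclideanSpace ℝ (Fin n) → EuclideanSpace ℝ (Fin m)) where
  toFun c := ∑ i : Fin (r + 1), ((i : ℕ).factorial : ℝ)⁻¹ • diagonal (c i).1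
  map_add' c c' := by
    rw [← Finset.sum_add_distrib]
    exact Finset.sum_congr rfl fun i _ => by rw [← smul_add]; rfl
  map_smul' a c := by
    rw [Finset.smul_sum]
    exact Finset.sum_congr rfl fun i _ => by rw [smul_comm]; rfl

theorem contDiff_taylorPoly {r : ℕ} (c : JetFiber n m r) {N : WithTop ℕ∞} :
    ContDiff ℝ N (taylorPoly n m r c) := by
  have : ContDiff ℝ N fun y => ∑ i : Fin (r + 1), ((i : ℕ).factorial : ℝ)⁻¹ •
      diagonal (c i).1 y :=
    ContDiff.sum fun i _ => (contDiff_diagonal _).const_smul _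
  convert this using 1
  ext1 y
  simp [taylorPoly]

theorem iteratedFDeriv_taylorPoly {r : ℕ} (c : JetFiber n m r) (j : ℕ)
    (x : EuclideanSpace ℝ (Fin n)) :
    iteratedFDeriv ℝ j (taylorPoly n m r c) x =
      ∑ i : Fin (r + 1), ((i : ℕ).factorial : ℝ)⁻¹ • iteratedFDeriv ℝ j (diagonal (c i).1) x := by
  have h : ∀ i ∈ Finset.univ, ContDiffAt ℝ j ((((i : Fin (r + 1)) : ℕ).factorial : ℝ)⁻¹ •
      diagonal (c i).1) x :=
    fun i _ => (contDiff_smul_diagonal _ _).contDiffAt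
  refine (iteratedFDeriv_sum_apply h).trans ?_
  exact Finset.sum_congr rfl fun i _ =>
    iteratedFDeriv_const_smul_apply (contDiff_diagonal _).contDiffAt

theorem iteratedFDeriv_taylorPoly_zero {r : ℕ} (c : JetFiber n m r)
    (j : Fin (r + 1)) : iteratedFDeriv ℝ j (taylorPoly n m r c) 0 = c j := by
  rw [iteratedFDeriv_taylorPoly, Finset.sum_eq_single j]
  · rw [iteratedFDeriv_diagonal_self _ _ (c j).2, smul_smul, inv_mul_cancel₀, one_smul]
    exact_mod_cast Nat.factorial_ne_zero _
  · intro i _ hij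
    rcases lt_or_gt_of_ne (Fin.val_injective.ne hij) with h | h
    · rw [iteratedFDeriv_diagonal_of_lt _ (c i).2 h, smul_zero]
    · rw [iteratedFDeriv_diagonal_zero _ _ _ (c i).2 h, smul_zero]
  · simp

theorem iteratedFDeriv_taylorPoly_of_lt {r : ℕ} (c : JetFiber n m r) {j : ℕ}
    (hj : r < j) (x : EuclideanSpace ℝ (Fin n)) :
    iteratedFDeriv ℝ j (taylorPoly n m r c) x = 0 := by
  rw [iteratedFDeriv_taylorPoly]
  refine Finset.sum_eq_zero fun i _ => ?_
  rw [iteratedFDeriv_diagonal_of_lt _ (c i).2 (lt_of_lt_of_le i.2 hj), smul_zero]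

/-- The polynomial maps of degree at most `r + 1`, parametrized by their derivatives of order at
most `r` and of order `r + 1` at the origin. -/
noncomputable def polyFun (n m r : ℕ) :
    JetFiber n m r × HomPoly n m (r + 1) →ₗ[ℝ]
      (EuclideanSpace ℝ (Fin n) → EuclideanSpace ℝ (Fin m)) where
  toFun q := taylorPoly n m r q.1 + ((r + 1).factorial : ℝ)⁻¹ • diagonal q.2.1
  map_add' p q := by
    rw [Prod.fst_add, map_add, add_add_add_comm, ← smul_add]
    rfl
  map_smul' a q := by
    rw [Prod.smul_fst, map_smul, RingHom.id_apply, smul_add, smul_comm a]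
    rfl

theorem contDiff_polyFun {r : ℕ} (q : JetFiber n m r × HomPoly n m (r + 1))
    {N : WithTop ℕ∞} : ContDiff ℝ N (polyFun n m r q) :=
  (contDiff_taylorPoly q.1).add (contDiff_smul_diagonal _ _)

theorem iteratedFDeriv_polyFun {r : ℕ}
    (q : JetFiber n m r × HomPoly n m (r + 1))
    (x : EuclideanSpace ℝ (Fin n)) :
    iteratedFDeriv ℝ (r + 1) (polyFun n m r q) x = q.2 := by
  have h : ContDiff ℝ (r + 1 : ℕ) (((r + 1).factorial : ℝ)⁻¹ • diagonal q.2.1) :=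
    contDiff_smul_diagonal _ _
  refine (iteratedFDeriv_add_apply (contDiff_taylorPoly q.1).contDiffAt h.contDiffAt).trans ?_
  rw [iteratedFDeriv_taylorPoly_of_lt q.1 r.lt_succ_self, zero_add,
    iteratedFDeriv_const_smul_apply (contDiff_diagonal _).contDiffAt,
    iteratedFDeriv_diagonal_self _ _ q.2.2, smul_smul, inv_mul_cancel₀, one_smul]
  exact_mod_cast Nat.factorial_ne_zero _

/-- The jet of order `r` at `x` of a polynomial map of degree at most `r + 1`. -/
noncomputable def polyJet (n m r : ℕ) (x : EuclideanSpace ℝ (Fin n)) :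
    JetFiber n m r × HomPoly n m (r + 1) →L[ℝ]
      JetFiber n m r :=
  LinearMap.toContinuousLinearMap (𝕜 := ℝ) (E := JetFiber n m r × HomPoly n m (r + 1))
    (F' := JetFiber n m r)
    { toFun := fun q => jetOf r (polyFun n m r q) x
      map_add' := fun p q => by
        rw [map_add, jetOf_add (contDiff_polyFun p).contDiffAt (contDiff_polyFun q).contDiffAt]
      map_smul' := fun a q => by
        rw [map_smul, jetOf_smul (contDiff_polyFun q).contDiffAt, RingHom.id_apply] }

theorem polyJet_apply {r : ℕ} (x : EuclideanSpace ℝ (Fin n))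
    (q : JetFiber n m r × HomPoly n m (r + 1)) :
    polyJet n m r x q = jetOf r (polyFun n m r q) x := rfl

theorem contDiff_polyJet (n m r : ℕ) : ContDiff ℝ 1 (polyJet n m r) := by
  rw [contDiff_clm_apply_iff]
  exact fun q => contDiff_iff_contDiffAt.2 fun x => contDiffAt_jetOf (contDiff_polyFun q).contDiffAt

/-- A polynomial map of degree at most `r` is determined by its jet of order `r` at a point. -/
theorem isInvertible_polyJet_comp_inl (n m r : ℕ) (x : EuclideanSpace ℝ (Fin n)) :
    ((polyJet n m r x).comp (ContinuousLinearMap.inl ℝ (JetFiber n m r) (HomPoly n m (r + 1)))).IsInvertible := by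
  set L := (polyJet n m r x).comp (ContinuousLinearMap.inl ℝ (JetFiber n m r) (HomPoly n m (r + 1))) with hL
  have hinj : Function.Injective L.toLinearMap := by
    refine (injective_iff_map_eq_zero L.toLinearMap).2 ?_
    intro c hc
    have hfun : polyFun n m r (c, 0) = taylorPoly n m r c := by
      change taylorPoly n m r c + ((r + 1).factorial : ℝ)⁻¹ • diagonal
        (0 : EuclideanSpace ℝ (Fin n) [×(r + 1)]→L[ℝ] EuclideanSpace ℝ (Fin m)) = _
      ext1 y
      simp [diagonal]
    have hc' : jetOf r (taylorPoly n m r c) x = 0 := by rw [← hfun]; exact hc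
    have h0 : ∀ i ≤ r, iteratedFDeriv ℝ i (taylorPoly n m r c) x = 0 := fun i hi => by
      have h1 := congr_fun hc' ⟨i, Nat.lt_succ_of_le hi⟩
      -- Derivatives of smooth maps are symmetric, so the projection in `jetOf` loses nothing.
      have h2 := symProj_coe (n := n) (m := m) ⟨iteratedFDeriv ℝ i (taylorPoly n m r c) x,
        iteratedFDeriv_comp_perm (contDiff_taylorPoly c).contDiffAt⟩
      have h3 := h2.symm.trans h1
      exact congr_arg Subtype.val h3
    funext j
    rw [← Subtype.coe_inj, ← iteratedFDeriv_taylorPoly_zero c j]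
    exact iteratedFDeriv_eq_zero_of_jet_eq_zero (contDiff_taylorPoly c)
      (iteratedFDeriv_taylorPoly_of_lt c r.lt_succ_self) h0 (by omega) 0
  exact ⟨(LinearEquiv.ofInjectiveEndo L.toLinearMap hinj).toContinuousLinearEquiv, by ext1; rfl⟩

/-- The restriction to `A` of a smooth map, as a linear map on the polynomial maps. -/
noncomputable def polyCFun (n m r : ℕ) (l : ℕ∞) (A : Opens (EuclideanSpace ℝ (Fin n))) :
    JetFiber n m r × HomPoly n m (r + 1) →ₗ[ℝ] CFun n m l A where
  toFun q := ⟨(A : Set _).indicator (polyFun n m r q),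
    (contDiff_polyFun q).contDiffOn.congr fun _ hx => indicator_of_mem hx _,
    fun _ hx => indicator_of_notMem hx _⟩
  map_add' p q := Subtype.ext ((congr_arg (A : Set _).indicator (map_add (polyFun n m r) p q)).trans
    (indicator_add _ _ _))
  map_smul' a q := Subtype.ext ((congr_arg (A : Set _).indicator (map_smul (polyFun n m r) a q)).trans
    (indicator_const_smul (A : Set _) a (polyFun n m r q)))

theorem polyCFun_eventuallyEq {r : ℕ} (x : A)
    (q : JetFiber n m r × HomPoly n m (r + 1)) :
    (polyCFun n m r l A q).1 =ᶠ[𝓝 x.1] polyFun n m r q := by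
  filter_upwards [A.isOpen.mem_nhds x.2] with y hy
  exact indicator_of_mem hy (polyFun n m r q)

/-- The action of the polynomial family on jets. -/
theorem splitJet_add_polyCFun {r : ℕ} (hr : ((r + 1 : ℕ) : ℕ∞) ≤ l) (f : CFun n m l A) (x : A)
    (q : JetFiber n m r × HomPoly n m (r + 1)) :
    splitJet (r + 1) hr (f + polyCFun n m r l A q) x =
      ((x.1, jetOf r f.1 x.1 + polyJet n m r x.1 q), derivAt (r + 1) hr f x + q.2) := by
  have hr' : (r : ℕ∞) ≤ l := le_trans (by exact_mod_cast r.le_succ) hr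
  have hf := f.contDiffAt hr x
  refine Prod.ext ((jet_eq_jetOf hr' _ x).trans (Prod.ext rfl ?_)) (Subtype.ext ?_)
  · change jetOf r (f.1 + (polyCFun n m r l A q).1) x.1 = _
    rw [jetOf_add (f.contDiffAt hr' x) ((polyCFun n m r l A q).contDiffAt hr' x), polyJet_apply]
    congr 1
    funext i
    simp only [jetOf]
    rw [((polyCFun_eventuallyEq x q).iteratedFDeriv ℝ i).eq_of_nhds]
  · change iteratedFDeriv ℝ (r + 1) (f.1 + (polyCFun n m r l A q).1) x.1 =
      iteratedFDeriv ℝ (r + 1) f.1 x.1 + q.2.1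
    rw [iteratedFDeriv_add_apply hf ((polyCFun n m r l A q).contDiffAt hr x),
      ((polyCFun_eventuallyEq x q).iteratedFDeriv ℝ (r + 1)).eq_of_nhds, iteratedFDeriv_polyFun]

/-! ### Polynomial maps -/

/-- Expanding every argument in the standard basis writes the form as a sum of monomials of degree
`i`, indexed by the choice of a basis vector in each slot. -/
theorem exists_mvPolynomial_diagonal {i : ℕ}
    (s : EuclideanSpace ℝ (Fin n) [×i]→L[ℝ] EuclideanSpace ℝ (Fin m)) (j : Fin m) :
    ∃ p : MvPolynomial (Fin n) ℝ, p.totalDegree ≤ i ∧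
      ∀ x, diagonal s x j = MvPolynomial.eval (fun a => x a) p := by
  classical
  let e : Fin n → EuclideanSpace ℝ (Fin n) := fun a => EuclideanSpace.single a 1
  refine ⟨∑ t : Fin i → Fin n, MvPolynomial.C (s (fun a => e (t a)) j) *
    ∏ a, MvPolynomial.X (t a), ?_, fun x => ?_⟩
  · refine MvPolynomial.totalDegree_finsetSum_le fun t _ => ?_
    refine (MvPolynomial.totalDegree_mul _ _).trans ?_
    rw [MvPolynomial.totalDegree_C, zero_add]
    refine (MvPolynomial.totalDegree_finsetProd _ _).trans ?_
    simp
  · have hx : x = ∑ a, x a • e a := by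
      ext b
      simp [e, Pi.single_apply]
    have h1 : diagonal s x = ∑ t : Fin i → Fin n, s fun a => x (t a) • e (t a) := by
      rw [← s.map_sum (fun (_ : Fin i) (b : Fin n) => x b • e b), ← hx]
      rfl
    rw [h1, map_sum]
    simp only [ContinuousMultilinearMap.map_smul_univ, map_mul, map_prod, MvPolynomial.eval_C,
      MvPolynomial.eval_X]
    rw [WithLp.ofLp_sum, Finset.sum_apply]
    exact Finset.sum_congr rfl fun t _ => by simp [mul_comm]

theorem polyCFun_mem_polynomials {r : ℕ}
    (q : JetFiber n m r × HomPoly n m (r + 1)) :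
    polyCFun n m r l A q ∈ polynomials n m l A (r + 1) := by
  choose p hp hpe using fun (i : Fin (r + 1)) => exists_mvPolynomial_diagonal (q.1 i).1
  choose p' hp' hpe' using exists_mvPolynomial_diagonal q.2.1
  refine ⟨fun j => (∑ i : Fin (r + 1), ((i : ℕ).factorial : ℝ)⁻¹ • p i j) + ((r + 1).factorial : ℝ)⁻¹ • p' j,
    fun j => ?_, fun x hx j => ?_⟩
  · refine (MvPolynomial.totalDegree_add _ _).trans (max_le ?_ ?_)
    · refine MvPolynomial.totalDegree_finsetSum_le fun i _ => ?_
      exact (MvPolynomial.totalDegree_smul_le _ _).trans ((hp i j).trans (by omega))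
    · exact (MvPolynomial.totalDegree_smul_le _ _).trans (hp' j)
  · have h : (polyCFun n m r l A q).1 x = polyFun n m r q x := indicator_of_mem hx _
    rw [h]
    change (taylorPoly n m r q.1 x + ((r + 1).factorial : ℝ)⁻¹ • diagonal q.2.1 x) j = _
    simp [taylorPoly, hpe, hpe', MvPolynomial.smul_eval]

/-- The comparison takes place among functions on `A`: restriction to `A` is injective on functions
extended by zero, and its image lies in the range of evaluation on a finite-dimensional space of
coefficients. Evaluation itself may fail to be injective, for instance if `A` is empty. -/
instance finiteDimensional_polynomials (k : ℕ) :
    FiniteDimensional ℝ (polynomials n m l A k) := by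
  let ev : polynomials n m l A k →ₗ[ℝ] (A → Fin m → ℝ) :=
    { toFun := fun f x j => f.1 x.1 j
      map_add' := fun f g => rfl
      map_smul' := fun a f => rfl }
  have hev : Function.Injective ev := fun f g h => by
    refine Subtype.ext (Subtype.ext (funext fun x => ?_))
    by_cases hx : x ∈ A
    · ext j
      exact congr_fun (congr_fun h ⟨x, hx⟩) j
    · exact (f.1.2.2 x hx).trans (g.1.2.2 x hx).symm
  let T : (Fin m → MvPolynomial.restrictTotalDegree (Fin n) ℝ k) →ₗ[ℝ] (A → Fin m → ℝ) :=
    { toFun := fun p x j => MvPolynomial.eval (fun a => x.1 a) (p j).1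
      map_add' := fun p q => by ext; simp
      map_smul' := fun a p => by ext; simp [MvPolynomial.smul_eval] }
  have hT : LinearMap.range ev ≤ LinearMap.range T := by
    rintro _ ⟨⟨f, p, hp, hf⟩, rfl⟩
    refine ⟨fun j => ⟨p j, (MvPolynomial.mem_restrictTotalDegree _ _ _).2 (hp j)⟩, ?_⟩
    ext x j
    exact (hf x x.2 j).symm
  have : FiniteDimensional ℝ (LinearMap.range ev) := Submodule.finiteDimensional_of_le hT
  exact (LinearEquiv.ofInjective ev hev).symm.finiteDimensional

end Jets

/-! ### Jets as functions of the map -/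

section Topology

variable {n m : ℕ} {l : ℕ∞} {A : Opens (EuclideanSpace ℝ (Fin n))}

theorem continuous_derivMap (i : {i : ℕ // (i : ℕ∞) ≤ l}) : Continuous (derivMap n m l A i) :=
  continuous_iff_le_induced.2 (iInf_le _ i)

instance : T2Space (CFun n m l A) := by
  refine T2Space.of_injective_continuous (f := derivMap n m l A ⟨0, by simp⟩) (fun f g h => ?_)
    (continuous_derivMap _)
  refine Subtype.ext (funext fun x => ?_)
  by_cases hx : x ∈ A
  · have h1 := congr_arg (fun F : ContinuousMultilinearMap ℝ
      (fun _ : Fin 0 => EuclideanSpace ℝ (Fin n)) (EuclideanSpace ℝ (Fin m)) => F 0)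
      (DFunLike.congr_fun h ⟨x, hx⟩)
    exact h1
  · exact (f.2.2 x hx).trans (g.2.2 x hx).symm

/-- Joint continuity holds because evaluation is jointly continuous for the compact-open topology
over the locally compact space `A`. -/
theorem continuous_derivAt {i : ℕ} (hi : (i : ℕ∞) ≤ l) :
    Continuous fun p : CFun n m l A × A => derivAt i hi p.1 p.2 := by
  have : LocallyCompactSpace A := A.isOpen.locallyCompactSpace
  refine Continuous.subtype_mk ?_ _
  have h : Continuous fun p : CFun n m l A × A => (derivMap n m l A ⟨i, hi⟩ p.1, p.2) :=
    ((continuous_derivMap _).comp continuous_fst).prodMk continuous_snd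
  exact ContinuousEval.continuous_eval.comp h

theorem continuous_splitJet {k : ℕ} (hk : (k : ℕ∞) ≤ l) :
    Continuous fun p : CFun n m l A × A => splitJet k hk p.1 p.2 :=
  ((continuous_subtype_val.comp continuous_snd).prodMk
    (continuous_pi fun _ => continuous_derivAt _)).prodMk (continuous_derivAt hk)

/-- The maps whose jets meet a given set. -/
def jetHits {k : ℕ} (hk : (k : ℕ∞) ≤ l) (A : Opens (EuclideanSpace ℝ (Fin n)))
    (Z : Set (JetSpace n m (k - 1) × HomPoly n m k)) : Set (CFun n m l A) :=
  {f | ∃ x : A, splitJet k hk f x ∈ Z}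

theorem jetHits_iUnion {k : ℕ} (hk : (k : ℕ∞) ≤ l) {ι : Sort*}
    (Z : ι → Set (JetSpace n m (k - 1) × HomPoly n m k)) :
    jetHits hk A (⋃ i, Z i) = ⋃ i, jetHits hk A (Z i) := by
  ext f
  simp only [jetHits, mem_iUnion, mem_ofPred_eq]
  exact exists_comm

theorem jetHits_mono {k : ℕ} (hk : (k : ℕ∞) ≤ l)
    {Z Z' : Set (JetSpace n m (k - 1) × HomPoly n m k)} (h : Z ⊆ Z') :
    jetHits hk A Z ⊆ jetHits hk A Z' :=
  fun _ ⟨x, hx⟩ => ⟨x, h hx⟩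

/-- A jet in `C` can only occur over the compact set of base points of `C`, and projection along a
compact factor is a closed map. -/
theorem isClosed_jetHits {k : ℕ} (hk : (k : ℕ∞) ≤ l)
    {C : Set (JetSpace n m (k - 1) × HomPoly n m k)} (hC : IsCompact C)
    (hCA : ∀ w ∈ C, w.1.1 ∈ A) : IsClosed (jetHits hk A C) := by
  let B : Set A := Subtype.val ⁻¹' ((fun w => w.1.1) '' C)
  have hB : IsCompact B := by
    refine Subtype.isCompact_iff.2 ?_
    have : Subtype.val '' B = (fun w => w.1.1) '' C := by
      refine image_preimage_eq_of_subset ?_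
      rintro _ ⟨w, hw, rfl⟩
      exact ⟨⟨_, hCA w hw⟩, rfl⟩
    rw [this]
    exact hC.image (continuous_fst.comp continuous_fst)
  have : CompactSpace B := isCompact_iff_compactSpace.1 hB
  have hcl : IsClosed {p : CFun n m l A × B | splitJet k hk p.1 p.2.1 ∈ C} :=
    hC.isClosed.preimage ((continuous_splitJet hk).comp
      (continuous_fst.prodMk (continuous_subtype_val.comp continuous_snd)))
  convert isClosedMap_fst_of_compactSpace _ hcl using 1
  ext f
  constructor
  · rintro ⟨x, hx⟩
    exact ⟨(f, ⟨x, mem_image_of_mem (fun w => w.1.1) hx⟩), hx, rfl⟩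
  · rintro ⟨p, hp, rfl⟩
    exact ⟨p.2.1, hp⟩

end Topology

/-! ### Maps whose jets meet a null set -/

section Local

variable {n m d D r : ℕ} {l : ℕ∞} {A : Opens (EuclideanSpace ℝ (Fin n))}

/-- The polynomial family in linear coordinates. -/
noncomputable def polyFamily (l : ℕ∞) (A : Opens (EuclideanSpace ℝ (Fin n)))
    (e : EuclideanSpace ℝ (Fin d) ≃L[ℝ] JetFiber n m r)
    (e' : EuclideanSpace ℝ (Fin D) ≃L[ℝ] HomPoly n m (r + 1)) :
    EuclideanSpace ℝ (Fin d) × EuclideanSpace ℝ (Fin D) →ₗ[ℝ] CFun n m l A :=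
  polyCFun n m r l A ∘ₗ e.toLinearMap.prodMap e'.toLinearMap

/-- The maps whose jets meet `Z` are contained in a Borel set of which every translate is null along
the polynomial family. -/
def IsAvoidable (hr : ((r + 1 : ℕ) : ℕ∞) ≤ l) (A : Opens (EuclideanSpace ℝ (Fin n)))
    (e : EuclideanSpace ℝ (Fin d) ≃L[ℝ] JetFiber n m r)
    (e' : EuclideanSpace ℝ (Fin D) ≃L[ℝ] HomPoly n m (r + 1))
    (Z : Set (JetSpace n m r × HomPoly n m (r + 1))) : Prop :=
  ∃ S : Set (CFun n m l A), MeasurableSet S ∧ jetHits hr A Z ⊆ S ∧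
    ∀ f, volume {p | f + polyFamily l A e e' p ∈ S} = 0

theorem IsAvoidable.mono {hr : ((r + 1 : ℕ) : ℕ∞) ≤ l}
    {e : EuclideanSpace ℝ (Fin d) ≃L[ℝ] JetFiber n m r}
    {e' : EuclideanSpace ℝ (Fin D) ≃L[ℝ] HomPoly n m (r + 1)}
    {Z Z' : Set (JetSpace n m r × HomPoly n m (r + 1))} (h : IsAvoidable hr A e e' Z')
    (hZ : Z ⊆ Z') : IsAvoidable hr A e e' Z :=
  h.imp fun _ hS => ⟨hS.1, (jetHits_mono hr hZ).trans hS.2.1, hS.2.2⟩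

theorem IsAvoidable.iUnion {hr : ((r + 1 : ℕ) : ℕ∞) ≤ l}
    {e : EuclideanSpace ℝ (Fin d) ≃L[ℝ] JetFiber n m r}
    {e' : EuclideanSpace ℝ (Fin D) ≃L[ℝ] HomPoly n m (r + 1)} {ι : Type*} [Countable ι]
    {Z : ι → Set (JetSpace n m r × HomPoly n m (r + 1))}
    (h : ∀ i, IsAvoidable hr A e e' (Z i)) : IsAvoidable hr A e e' (⋃ i, Z i) := by
  choose S hS hZS hnull using h
  refine ⟨⋃ i, S i, MeasurableSet.iUnion hS, ?_, fun f => ?_⟩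
  · exact (jetHits_iUnion hr Z).subset.trans (iUnion_mono hZS)
  · have : {p | f + polyFamily l A e e' p ∈ ⋃ i, S i} =
        ⋃ i, {p | f + polyFamily l A e e' p ∈ S i} := by
      ext p; simp
    rw [this, measure_iUnion_null_iff]
    exact fun i => hnull i f

/-- Jets along a null set in `C¹` coordinates are avoidable. -/
theorem isAvoidable_image (hr : ((r + 1 : ℕ) : ℕ∞) ≤ l)
    (e : EuclideanSpace ℝ (Fin d) ≃L[ℝ] JetFiber n m r)
    (e' : EuclideanSpace ℝ (Fin D) ≃L[ℝ] HomPoly n m (r + 1))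
    {U : Set (EuclideanSpace ℝ (Fin d))} (hU : IsOpen U)
    {g : EuclideanSpace ℝ (Fin d) → JetSpace n m r} (hg : ContDiffOn ℝ 1 g U)
    (hgA : ∀ a ∈ U, (g a).1 ∈ A)
    {K : Set (EuclideanSpace ℝ (Fin d) × EuclideanSpace ℝ (Fin D))} (hK : IsCompact K)
    (hKU : K ⊆ U ×ˢ univ) {N : Set (EuclideanSpace ℝ (Fin d) × EuclideanSpace ℝ (Fin D))}
    (hNK : N ⊆ K) (hN : volume N = 0) :
    IsAvoidable hr A e e' ((fun p => (g p.1, e' p.2)) '' N) := by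
  set γ : EuclideanSpace ℝ (Fin d) × EuclideanSpace ℝ (Fin D) →
    JetSpace n m r × HomPoly n m (r + 1) := fun p => (g p.1, e' p.2) with hγ
  have hγc : ContinuousOn γ K :=
    (hg.continuousOn.comp continuousOn_fst fun p hp => (hKU hp).1).prodMk
      (e'.continuous.comp_continuousOn continuousOn_snd)
  -- `N` need not be Borel, so it is replaced by open supersets of small measure.
  have hG : ∀ j : ℕ, ∃ G ⊇ N, IsOpen G ∧ volume G < ((j : ENNReal) + 1)⁻¹ := fun j =>
    N.exists_isOpen_lt_of_lt _ (by rw [hN]; simp)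
  choose G hNG hGo hGv using hG
  refine ⟨⋂ j, jetHits hr A (γ '' (G j ∩ K)), MeasurableSet.iInter fun j => ?_, ?_, fun f => ?_⟩
  · obtain ⟨F, hF, -, hFU, -⟩ := (hGo j).exists_iUnion_isClosed
    rw [← hFU, iUnion_inter, image_iUnion, jetHits_iUnion]
    refine MeasurableSet.iUnion fun i => (isClosed_jetHits hr ?_ ?_).measurableSet
    · exact (hK.inter_left (hF i)).image_of_continuousOn (hγc.mono inter_subset_right)
    · rintro _ ⟨p, hp, rfl⟩
      exact hgA _ (hKU hp.2).1
  · exact subset_iInter fun j => jetHits_mono hr (image_mono (subset_inter (hNG j) hNK))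
  have hfst : ContDiffOn ℝ 1 (fun a => (g a).1) U := contDiff_fst.comp_contDiffOn hg
  set Df : EuclideanSpace ℝ (Fin d) → EuclideanSpace ℝ (Fin D) := fun a =>
    e'.symm (symProj n m (r + 1) (iteratedFDeriv ℝ (r + 1) f.1 (g a).1)) with hDf
  have hDfc : ContinuousOn Df U := by
    intro a ha
    have h1 : ContDiffAt ℝ 0 (iteratedFDeriv ℝ (r + 1) f.1) (g a).1 :=
      (f.contDiffAt hr ⟨_, hgA a ha⟩).iteratedFDeriv_right (by simp)
    have h2 : ContinuousWithinAt (fun a => iteratedFDeriv ℝ (r + 1) f.1 (g a).1) U a :=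
      ContinuousAt.comp_continuousWithinAt (f := fun a => (g a).1) h1.continuousAt
        (hfst.continuousOn a ha)
    exact ((e'.symm.continuous.comp (symProj n m (r + 1)).continuous).continuousAt
      ).comp_continuousWithinAt h2
  set inl := ContinuousLinearMap.inl ℝ (JetFiber n m r) (HomPoly n m (r + 1)) with hinl
  -- `R (a, s)` solves for the lower-order part of the polynomial once its part `s` of top degree is
  -- known, so that the perturbed jet of order `r` at the base point of `g a` is `g a`.
  set R : EuclideanSpace ℝ (Fin d) × EuclideanSpace ℝ (Fin D) →
      EuclideanSpace ℝ (Fin d) × EuclideanSpace ℝ (Fin D) := fun p =>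
    (e.symm (((polyJet n m r (g p.1).1).comp inl).inverse
      ((g p.1).2 - jetOf r f.1 (g p.1).1 - polyJet n m r (g p.1).1 (0, e' p.2))), p.2) with hR
  have hRc : ContDiffOn ℝ 1 R (U ×ˢ univ) := by
    intro p hp
    have hg1 : ContDiffWithinAt ℝ 1 (fun p : _ × EuclideanSpace ℝ (Fin D) => g p.1)
        (U ×ˢ univ) p := (hg p.1 hp.1).comp p contDiffWithinAt_fst fun q hq => hq.1
    have hx : ContDiffWithinAt ℝ 1 (fun p : _ × EuclideanSpace ℝ (Fin D) => (g p.1).1)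
        (U ×ˢ univ) p := contDiffAt_fst.comp_contDiffWithinAt p hg1
    have hy : ContDiffWithinAt ℝ 1 (fun p : _ × EuclideanSpace ℝ (Fin D) => (g p.1).2)
        (U ×ˢ univ) p := contDiffAt_snd.comp_contDiffWithinAt p hg1
    have hjf : ContDiffWithinAt ℝ 1 (fun p : _ × EuclideanSpace ℝ (Fin D) =>
        jetOf r f.1 (g p.1).1) (U ×ˢ univ) p :=
      ContDiffAt.comp_contDiffWithinAt (g := jetOf r f.1) p
        (contDiffAt_jetOf (f.contDiffAt hr ⟨_, hgA _ hp.1⟩)) hx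
    have hP : ContDiffWithinAt ℝ 1 (fun p : _ × EuclideanSpace ℝ (Fin D) =>
        polyJet n m r (g p.1).1) (U ×ˢ univ) p :=
      (contDiff_polyJet n m r).contDiffAt.comp_contDiffWithinAt p hx
    have hI : ContDiffWithinAt ℝ 1 (fun p : _ × EuclideanSpace ℝ (Fin D) =>
        ((polyJet n m r (g p.1).1).comp inl).inverse) (U ×ˢ univ) p :=
      ContDiffAt.comp_contDiffWithinAt (g := ContinuousLinearMap.inverse) p
        (isInvertible_polyJet_comp_inl n m r (g p.1).1).contDiffAt_map_inverse
        (hP.clm_comp contDiffWithinAt_const)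
    have he : ContDiffWithinAt ℝ 1 (fun p : EuclideanSpace ℝ (Fin d) × EuclideanSpace ℝ (Fin D) =>
        ((0 : JetFiber n m r), e' p.2)) (U ×ˢ univ) p :=
      contDiffWithinAt_const.prodMk (e'.contDiff.contDiffAt.comp_contDiffWithinAt p
        contDiffWithinAt_snd)
    exact (e.symm.contDiff.contDiffAt.comp_contDiffWithinAt p
      (hI.clm_apply ((hy.sub hjf).sub (hP.clm_apply he)))).prodMk contDiffWithinAt_snd
  obtain ⟨C, hC⟩ := exists_measure_image_shear_le volume volume hU hDfc hRc hK hKU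
  -- The target point `(g a, e' t)` determines the polynomial: the top derivative forces `s = t - Df
  -- a`, and the lower jet then forces `c`.
  have hsub : ∀ B ⊆ K, {p | f + polyFamily l A e e' p ∈ jetHits hr A (γ '' B)} ⊆
      (fun p => R (p.1, p.2 - Df p.1)) '' B := by
    rintro B hB ⟨c, s⟩ ⟨x, ⟨a, t⟩, hat, hx⟩
    have hj := splitJet_add_polyCFun hr f x (e c, e' s)
    have hx' : (g a, e' t) =
        ((x.1, jetOf r f.1 x.1 + polyJet n m r x.1 (e c, e' s)), derivAt (r + 1) hr f x + e' s) :=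
      hx.trans hj
    obtain ⟨h1, h2⟩ := Prod.mk.inj hx'
    refine ⟨(a, t), hat, ?_⟩
    have hs : t - Df a = s := by
      have hD : Df a = e'.symm (derivAt (r + 1) hr f x) := by
        rw [hDf]
        simp only [h1]
        exact congr_arg _ (symProj_coe (derivAt (r + 1) hr f x))
      rw [hD, sub_eq_iff_eq_add, ← e'.injective.eq_iff, map_add, h2,
        ContinuousLinearEquiv.apply_symm_apply]
      exact add_comm _ _
    simp only [hs, hR, h1]
    have hsplit : polyJet n m r x.1 (e c, e' s) - polyJet n m r x.1 (0, e' s) =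
        ((polyJet n m r x.1).comp inl) (e c) := by
      rw [← map_sub]
      simp [hinl]
    rw [add_sub_cancel_left, hsplit,
      (isInvertible_polyJet_comp_inl n m r x.1).inverse_apply_eq.2 rfl,
      ContinuousLinearEquiv.symm_apply_apply]
  have hle : ∀ j : ℕ, volume {p | f + polyFamily l A e e' p ∈ ⋂ j, jetHits hr A (γ '' (G j ∩ K))}
      ≤ C * ((j : ENNReal) + 1)⁻¹ := fun j => by
    have hj : {p | f + polyFamily l A e e' p ∈ ⋂ j, jetHits hr A (γ '' (G j ∩ K))} ⊆
        {p | f + polyFamily l A e e' p ∈ jetHits hr A (γ '' (G j ∩ K))} :=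
      fun p hp => mem_iInter.1 (mem_ofPred_eq ▸ hp) j
    refine (measure_mono (hj.trans (hsub (G j ∩ K) inter_subset_right))).trans ?_
    refine (hC _ inter_subset_right ((hGo j).measurableSet.inter hK.measurableSet)).trans ?_
    exact mul_le_mul_right ((measure_mono inter_subset_left).trans (hGv j).le) _
  have hlim : Filter.Tendsto (fun j : ℕ => (C : ENNReal) * ((j : ENNReal) + 1)⁻¹) Filter.atTop
      (𝓝 (C * 0)) := by
    refine ENNReal.Tendsto.const_mul ?_ (Or.inr ENNReal.coe_ne_top)
    have := (Filter.tendsto_add_atTop_iff_nat 1).2 ENNReal.tendsto_inv_nat_nhds_zero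
    simpa using this
  rw [mul_zero] at hlim
  exact le_antisymm (ge_of_tendsto' hlim hle) zero_le

end Local

instance isAddHaarMeasure_volume_prod (d D : ℕ) :
    (volume : Measure (EuclideanSpace ℝ (Fin d) × EuclideanSpace ℝ (Fin D))).IsAddHaarMeasure :=
  Measure.prod.instIsAddHaarMeasure volume volume

/-! ### Flattenings -/

section Flattening

variable {W : Type*} [NormedAddCommGroup W] [NormedSpace ℝ W] {d c : ℕ}
  {φ : OpenPartialHomeomorph W (EuclideanSpace ℝ (Fin d) × EuclideanSpace ℝ (Fin c))} {M : Set W}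

/-- By the chain rule the derivatives of `φ` and `φ.symm` are mutually inverse linear maps. -/
theorem IsFlattening.finrank_eq (hφ : IsFlattening φ M) {x : W} (hx : x ∈ φ.source) :
    Module.finrank ℝ W = d + c := by
  have h1 : HasFDerivAt φ (fderiv ℝ φ x) x :=
    ((hφ.contDiffOn.differentiableOn one_ne_zero).differentiableAt
      (φ.open_source.mem_nhds hx)).hasFDerivAt
  have h2 : HasFDerivAt φ.symm (fderiv ℝ φ.symm (φ x)) (φ x) :=
    ((hφ.contDiffOn_symm.differentiableOn one_ne_zero).differentiableAt
      (φ.open_target.mem_nhds (φ.map_source hx))).hasFDerivAt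
  have h1' : HasFDerivAt φ (fderiv ℝ φ x) (φ.symm (φ x)) := by rwa [φ.left_inv hx]
  have h3 := (h2.comp x h1).congr_of_eventuallyEq (f₁ := id)
    ((φ.eventually_left_inverse hx).mono fun y hy => hy.symm)
  have h4 := (h1'.comp (φ x) h2).congr_of_eventuallyEq (f₁ := id)
    ((φ.eventually_right_inverse (φ.map_source hx)).mono fun y hy => hy.symm)
  have h5 := h3.unique (hasFDerivAt_id x)
  have h6 := h4.unique (hasFDerivAt_id (φ x))
  have e : W ≃ₗ[ℝ] _ := LinearEquiv.ofLinearMap (fderiv ℝ φ x).toLinearMap (fderiv ℝ φ.symm (φ x)).toLinearMap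
    (congr_arg ContinuousLinearMap.toLinearMap h6) (congr_arg ContinuousLinearMap.toLinearMap h5)
  simpa using e.finrank_eq

theorem IsFlattening.apply_snd (hφ : IsFlattening φ M) {x : W} (hxM : x ∈ M) (hx : x ∈ φ.source) :
    (φ x).2 = 0 :=
  (hφ.image_eq.subset ⟨x, ⟨hxM, hx⟩, rfl⟩).1

/-- A set that is null in a flattening of `M × H` is null in the coordinates that a flattening of
`M` and linear coordinates on `H` determine. -/
theorem IsFlattening.volume_prod_eq_zero {H : Type*} [NormedAddCommGroup H] [NormedSpace ℝ H]
    {D : ℕ} (hφ : IsFlattening φ M) (e : EuclideanSpace ℝ (Fin D) ≃L[ℝ] H) {c' : ℕ}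
    {ψ : OpenPartialHomeomorph (W × H)
      (EuclideanSpace ℝ (Fin (d + D)) × EuclideanSpace ℝ (Fin c'))}
    (hψ : IsFlattening ψ (M ×ˢ univ)) {Z : Set (W × H)} (hZM : Z ⊆ M ×ˢ univ)
    (hZ : volume {b : EuclideanSpace ℝ (Fin (d + D)) | (b, 0) ∈ ψ '' (Z ∩ ψ.source)} = 0) :
    volume {p : EuclideanSpace ℝ (Fin d) × EuclideanSpace ℝ (Fin D) |
      (p.1, 0) ∈ φ.target ∧ (φ.symm (p.1, 0), e p.2) ∈ Z ∩ ψ.source} = 0 := by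
  -- `α` is the transition from the `ψ`-coordinates on `M × H` to the product coordinates. It is
  -- differentiable where both charts are defined and preserves dimension, so it keeps null sets
  -- null.
  set α : EuclideanSpace ℝ (Fin (d + D)) → EuclideanSpace ℝ (Fin d) × EuclideanSpace ℝ (Fin D) :=
    fun b => ((φ (ψ.symm (b, 0)).1).1, e.symm (ψ.symm (b, 0)).2) with hα
  set s : Set (EuclideanSpace ℝ (Fin (d + D))) :=
    {b | (b, 0) ∈ ψ '' (Z ∩ ψ.source)} ∩ {b | (ψ.symm (b, 0)).1 ∈ φ.source} with hs
  have hαd : DifferentiableOn ℝ α s := by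
    rintro b ⟨⟨w, hw, hwb⟩, hb⟩
    have hbt : (b, 0) ∈ ψ.target := hwb ▸ ψ.map_source hw.2
    have h1 : DifferentiableAt ℝ (fun b => ψ.symm (b, 0)) b :=
      DifferentiableAt.comp (g := ψ.symm) b
        ((hψ.contDiffOn_symm.differentiableOn one_ne_zero).differentiableAt
          (ψ.open_target.mem_nhds hbt))
        (differentiableAt_id.prodMk (differentiableAt_const _))
    have h2 : DifferentiableAt ℝ (fun b => φ (ψ.symm (b, 0)).1) b :=
      DifferentiableAt.comp (g := φ) b
        ((hφ.contDiffOn.differentiableOn one_ne_zero).differentiableAt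
          (φ.open_source.mem_nhds hb)) h1.fst
    exact (h2.fst.prodMk (e.symm.differentiableAt.comp b h1.snd)).differentiableWithinAt
  have h0 : volume (α '' s) = 0 :=
    addHaar_image_eq_zero_of_finrank_eq (by simp) volume volume hαd
      (measure_mono_null inter_subset_left hZ)
  refine measure_mono_null ?_ h0
  rintro ⟨a, t⟩ ⟨ha, hZ', hw⟩
  have h2 : (ψ (φ.symm (a, 0), e t)).2 = 0 := hψ.apply_snd (hZM hZ') hw
  have h3 : ((ψ (φ.symm (a, 0), e t)).1, (0 : EuclideanSpace ℝ (Fin c'))) =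
      ψ (φ.symm (a, 0), e t) := Prod.ext rfl h2.symm
  have h4 : ψ.symm ((ψ (φ.symm (a, 0), e t)).1, 0) = (φ.symm (a, 0), e t) := by
    rw [h3, ψ.left_inv hw]
  refine ⟨(ψ (φ.symm (a, 0), e t)).1, ⟨⟨_, ⟨hZ', hw⟩, h3.symm⟩, ?_⟩, ?_⟩
  · change (ψ.symm _).1 ∈ φ.source
    rw [h4]
    exact φ.map_target ha
  · simp only [hα, h4, φ.right_inv ha, ContinuousLinearEquiv.symm_apply_apply]

end Flattening

/-- Near each of its points over `A`, `Z` is a null set in product coordinates inside a compact box;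
countably many such neighbourhoods suffice. Points of `Z` not over `A` are irrelevant, as no jet of
a map on `A` reaches them. -/
theorem isAvoidable_of_isZeroSetIn {n m r d D : ℕ} {l : ℕ∞}
    {A : Opens (EuclideanSpace ℝ (Fin n))} (hr : ((r + 1 : ℕ) : ℕ∞) ≤ l)
    (e : EuclideanSpace ℝ (Fin d) ≃L[ℝ] JetFiber n m r)
    (e' : EuclideanSpace ℝ (Fin D) ≃L[ℝ] HomPoly n m (r + 1)) {M : Set (JetSpace n m r)}
    {c c' : ℕ} (hM : IsManifoldIn d c M) {Z : Set (JetSpace n m r × HomPoly n m (r + 1))}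
    (hZ : IsZeroSetIn (d + D) c' (M ×ˢ univ) Z) : IsAvoidable hr A e e' Z := by
  have hloc : ∀ w ∈ Z ∩ {w | w.1.1 ∈ A}, ∃ O ∈ 𝓝 w, IsAvoidable hr A e e' (Z ∩ O) := by
    rintro ⟨y, t⟩ ⟨hyZ, hyA⟩
    obtain ⟨φ, hφ, hyφ⟩ := hM y (hZ.1 hyZ).1
    obtain ⟨ψ, hψ, hwψ, hnull⟩ := hZ.2 (y, t) (hZ.1 hyZ)
    have hsec : Continuous fun a : EuclideanSpace ℝ (Fin d) =>
        (a, (0 : EuclideanSpace ℝ (Fin c))) := continuous_id.prodMk continuous_const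
    have hV : IsOpen (φ.target ∩ φ.symm ⁻¹' {y | y.1 ∈ A}) :=
      φ.symm.isOpen_inter_preimage (A.isOpen.preimage continuous_fst)
    set U : Set (EuclideanSpace ℝ (Fin d)) :=
      {a | (a, 0) ∈ φ.target ∩ φ.symm ⁻¹' {y | y.1 ∈ A}} with hUdef
    have hU : IsOpen U := hV.preimage hsec
    have hy0 : φ y = ((φ y).1, 0) := Prod.ext rfl (hφ.apply_snd (hZ.1 hyZ).1 hyφ)
    have hyU : (φ y).1 ∈ U := by
      rw [hUdef, mem_ofPred_eq, ← hy0]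
      refine ⟨φ.map_source hyφ, ?_⟩
      rw [mem_preimage, φ.left_inv hyφ]
      exact hyA
    -- Closed balls give the compact set `K` that bounds the expansion factor; the neighbourhood of
    -- the jet uses the open balls inside them.
    obtain ⟨ρ, hρ, hρU⟩ := Metric.nhds_basis_closedBall.mem_iff.1 (hU.mem_nhds hyU)
    set K := Metric.closedBall (φ y).1 ρ ×ˢ Metric.closedBall (e'.symm t) 1 with hK
    set N := {p : EuclideanSpace ℝ (Fin d) × EuclideanSpace ℝ (Fin D) |
      (p.1, 0) ∈ φ.target ∧ (φ.symm (p.1, 0), e' p.2) ∈ Z ∩ ψ.source} with hN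
    have hg : ContDiffOn ℝ 1 (fun a => φ.symm (a, 0)) U :=
      hφ.contDiffOn_symm.comp (contDiff_id.prodMk contDiff_const).contDiffOn fun a ha => ha.1
    have havoid := isAvoidable_image (A := A) hr e e' hU hg (fun a ha => ha.2)
      (K := K) ((isCompact_closedBall _ _).prod (isCompact_closedBall _ _))
      (prod_mono hρU (subset_univ _)) (N := N ∩ K) inter_subset_right
      (measure_mono_null inter_subset_left (hφ.volume_prod_eq_zero e' hψ hZ.1 hnull))
    refine ⟨{w | w.1 ∈ φ.source ∧ w ∈ ψ.source ∧ (φ w.1).1 ∈ Metric.ball (φ y).1 ρ ∧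
      e'.symm w.2 ∈ Metric.ball (e'.symm t) 1}, ?_, havoid.mono ?_⟩
    · have h1 : ∀ᶠ w : JetSpace n m r × HomPoly n m (r + 1) in 𝓝 (y, t), w.1 ∈ φ.source :=
        continuous_fst.continuousAt.eventually_mem (φ.open_source.mem_nhds hyφ)
      have h2 : ∀ᶠ w in 𝓝 (y, t), w ∈ ψ.source := ψ.open_source.mem_nhds hwψ
      have h3 : ∀ᶠ w : JetSpace n m r × HomPoly n m (r + 1) in 𝓝 (y, t),
          (φ w.1).1 ∈ Metric.ball (φ y).1 ρ := by
        have : ContinuousAt (fun w : JetSpace n m r × HomPoly n m (r + 1) => (φ w.1).1) (y, t) :=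
          ContinuousAt.fst (ContinuousAt.comp (g := φ) (φ.continuousAt hyφ) continuousAt_fst)
        exact this.eventually_mem (Metric.ball_mem_nhds _ hρ)
      have h4 : ∀ᶠ w : JetSpace n m r × HomPoly n m (r + 1) in 𝓝 (y, t),
          e'.symm w.2 ∈ Metric.ball (e'.symm t) 1 :=
        (e'.symm.continuous.comp continuous_snd).continuousAt.eventually_mem
          (Metric.ball_mem_nhds _ one_pos)
      filter_upwards [h1, h2, h3, h4] with w h1 h2 h3 h4 using ⟨h1, h2, h3, h4⟩
    · rintro ⟨y', t'⟩ ⟨hw, h1, h2, h3, h4⟩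
      have h0 : ((φ y').1, (0 : EuclideanSpace ℝ (Fin c))) = φ y' :=
        Prod.ext rfl (hφ.apply_snd (hZ.1 hw).1 h1).symm
      have hw' : (φ.symm ((φ y').1, 0), e' (e'.symm t')) = (y', t') := by
        rw [h0, φ.left_inv h1, ContinuousLinearEquiv.apply_symm_apply]
      refine ⟨((φ y').1, e'.symm t'), ⟨⟨?_, ?_⟩, Metric.ball_subset_closedBall h3,
        Metric.ball_subset_closedBall h4⟩, hw'⟩
      · change ((φ y').1, 0) ∈ φ.target
        rw [h0]
        exact φ.map_source h1
      · change (φ.symm ((φ y').1, 0), e' (e'.symm t')) ∈ _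
        rw [hw']
        exact ⟨hw, h2⟩
  choose! O hO hOa using hloc
  have : ProperSpace (JetSpace n m r × HomPoly n m (r + 1)) := FiniteDimensional.proper ℝ _
  have : SecondCountableTopology (JetSpace n m r × HomPoly n m (r + 1)) := secondCountable_of_proper
  obtain ⟨t, htZ, htc, hcov⟩ :=
    countable_cover_nhdsWithin fun w hw => mem_nhdsWithin_of_mem_nhds (hO w hw)
  have := htc.to_subtype
  have hunion : IsAvoidable hr A e e' (⋃ w : t, Z ∩ O w) :=
    IsAvoidable.iUnion fun w => hOa w (htZ w.2)
  obtain ⟨S, hS, hSsub, hSnull⟩ := hunion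
  refine ⟨S, hS, fun f ⟨x, hx⟩ => hSsub ⟨x, ?_⟩, hSnull⟩
  obtain ⟨w, hw, hxw⟩ := mem_iUnion₂.1 (hcov ⟨hx, x.2⟩)
  exact mem_iUnion.2 ⟨⟨w, hw⟩, hx, hxw⟩

theorem isTransverse_lebesgueOn_of_isZeroSetIn {n m r d : ℕ} {l : ℕ∞}
    {A : Opens (EuclideanSpace ℝ (Fin n))} (hr : ((r + 1 : ℕ) : ℕ∞) ≤ l)
    {M : Set (JetSpace n m r)} (hM : IsManifoldIn d n M)
    {Z : Set (JetSpace n m r × HomPoly n m (r + 1))}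
    (hZ : IsZeroSetIn (d + Module.finrank ℝ (HomPoly n m (r + 1))) n (M ×ˢ univ) Z) :
    ∃ S : Set (CFun n m l A), MeasurableSet S ∧ jetHits hr A Z ⊆ S ∧
      IsTransverse (lebesgueOn (polynomials n m l A (r + 1))) S := by
  rcases M.eq_empty_or_nonempty with rfl | ⟨y, hy⟩
  -- With `M` empty there is no flattening to tie `d` to the jet space, but `Z` is empty too.
  · refine ⟨∅, MeasurableSet.empty, ?_, exists_isCompact_lebesgueOn _, by simp⟩
    rintro f ⟨x, hx⟩
    exact (hZ.1 hx).1.elim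
  obtain ⟨φ, hφ, hyφ⟩ := hM y hy
  -- The codimension of `M` cancels the `n` dimensions of the base, so `M` and the fibre of jets
  -- have the same dimension.
  have hd : Module.finrank ℝ (JetFiber n m r) = d := by
    have := hφ.finrank_eq hyφ
    rw [Module.finrank_prod, finrank_euclideanSpace_fin] at this
    change n + Module.finrank ℝ (JetFiber n m r) = d + n at this
    omega
  let e : EuclideanSpace ℝ (Fin d) ≃L[ℝ] JetFiber n m r :=
    ContinuousLinearEquiv.ofFinrankEq (by rw [finrank_euclideanSpace_fin, hd])
  let e' : EuclideanSpace ℝ (Fin (Module.finrank ℝ (HomPoly n m (r + 1)))) ≃L[ℝ]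
      HomPoly n m (r + 1) := ContinuousLinearEquiv.ofFinrankEq (by rw [finrank_euclideanSpace_fin])
  obtain ⟨S, hS, hZS, hnull⟩ := isAvoidable_of_isZeroSetIn (A := A) hr e e' hM hZ
  exact ⟨S, hS, hZS, exists_isCompact_lebesgueOn _, lebesgueOn_image_add_eq_zero volume _
    (polyFamily l A e e') (fun _ => polyCFun_mem_polynomials _) hS hnull⟩

end MeasureJet

theorem mainTheorem7 (n m k d : ℕ) (hk : 1 ≤ k)
    (A : TopologicalSpace.Opens (EuclideanSpace ℝ (Fin n)))
    (M : Set (JetSpace n m (k - 1))) (hM : IsManifoldIn d n M)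
    (hπ : IsSubmersionOn d n M
      (Prod.fst : JetSpace n m (k - 1) → EuclideanSpace ℝ (Fin n)))
    (Z : Set (JetSpace n m (k - 1) × HomPoly n m k))
    (hZ : IsZeroSetIn (d + Module.finrank ℝ (HomPoly n m k)) n (M ×ˢ Set.univ) Z)
    (l : ℕ∞) (hkl : (k : ℕ∞) ≤ l) :
    IsPrevalent {f : CFun n m l A | ∀ x : A, splitJet k hkl f x ∉ Z} ∧
      IsProbe (polynomials n m l A k) {f : CFun n m l A | ∀ x : A, splitJet k hkl f x ∉ Z} := by
  -- Writing `k = r + 1` turns the index `k - 1` into `r` definitionally.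
  obtain ⟨r, rfl⟩ : ∃ r, k = r + 1 := ⟨k - 1, by omega⟩
  obtain ⟨S, hS, hZS, hT⟩ := isTransverse_lebesgueOn_of_isZeroSetIn (A := A) hkl hM hZ
  have hsub : {f : CFun n m l A | ∀ x : A, splitJet (r + 1) hkl f x ∉ Z}ᶜ ⊆ S := fun f hf => by
    simp only [mem_compl_iff, mem_ofPred_eq, not_forall, not_not] at hf
    exact hZS hf
  -- Lebesgue measure on the probe is itself the transverse measure that witnesses prevalence.
  exact ⟨⟨S, hS, hsub, _, hT⟩, inferInstance, S, hS, hsub, hT⟩
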